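/- For $k\ge 4$ let $L_{(k,a_i)}$ be the group with generators $a_0,\dots,a_k$ and the $k$ relations $a_k=a_ia_{i-1}a_i^{-1}$ ($1\le i\le k-1$) and $a_{k-1}=a_0a_ka_0^{-1}$; for $k=4$ this is the five-generator LOT (labeled oriented tree) group $$L_{(a_i)}=\langle a_0,\dots,a_4\mid a_4=a_1a_0a_1^{-1},\ a_4=a_2a_1a_2^{-1},\ a_4=a_3a_2a_3^{-1},\ a_3=a_0a_4a_0^{-1}\rangle .$$ Let $X_{L_{(k,a_i)}}$ be its presentation 2-complex: a bouquet of $k+1$ circles of length $1$, labeled by the generators, with one Euclidean unit square attached for each relation $u=ava^{-1}$ along the word $av(ua)^{-1}$; write $X_{L_{(a_i)}}=X_{L_{(4,a_i)}}$. Give its universal cover the lifted square complex structure and the intrinsic metric of a piecewise Euclidean complex (the distance of two points is the infimum of the lengths of the strings, i.e. finite sequences of points with consecutive points in a common cell, that join them, where lengths are measured by Euclidean distances within the cells). **Theorem.** The universal cover of $X_{L_{(a_i)}}$ contains no isometrically embedded flat plane, i.e. there is no isometric embedding of the Euclidean plane $\mathbb{E}^2$ into it. Moreover, every square of $X_{L_{(a_i)}}$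 has a poison corner, that is, a corner whose edge in the link of the vertex lies in no circuit of length four of the link. The same two statements hold for $X_{L_{(k,a_i)}}$ for every $k\ge 4$. -/

import Mathlib

/-- A labeled oriented graph: `V` is the set of vertices, which are their own (distinct) labels, and
`E` is the set of edges; the edge `e` is oriented from `src e` to `tgt e` and is labeled by the vertex
label `label e`. An edge labeled `a` from `u` to `v` stands for the relation `a v a⁻¹ = u`. -/
@[ext] structure LOG (V E : Type) where
  src : E → V
  tgt : E → V
  label : E → V

namespace LOG

variable {V E : Type}

/-- The disjoint union of the cells of the presentation 2-complex: one 0-cell, a unit interval for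
every generator, and a Euclidean unit square for every relation. -/
abbrev Cells (V E : Type) : Type :=
  Unit ⊕ (Σ _ : V, unitInterval) ⊕ (Σ _ : E, unitInterval × unitInterval)

/-- The point of parameter `t` on the interval of the generator `a`. -/
def edgePt (a : V) (t : unitInterval) : Cells V E := Sum.inr (Sum.inl ⟨a, t⟩)

/-- The point with coordinates `z` in the square of the relation `e`. -/
def squarePt (e : E) (z : unitInterval × unitInterval) : Cells V E := Sum.inr (Sum.inr ⟨e, z⟩)

/-- The gluing of the cells. Both ends of every interval are glued to the 0-cell. The square of the
relation `a v = u a` (that is, `a v a⁻¹ = u`) has bottom and top side `a` (read from left to right),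
left side `u` and right side `v` (both read upwards), so that its two boundary paths
from the lower left to the upper right corner read `a v` and `u a`. -/
inductive Glue (Γ : LOG V E) : Cells V E → Cells V E → Prop
  | start (a : V) : Glue Γ (edgePt a 0) (Sum.inl ())
  | finish (a : V) : Glue Γ (edgePt a 1) (Sum.inl ())
  | bottom (e : E) (t : unitInterval) : Glue Γ (squarePt e (t, 0)) (edgePt (Γ.label e) t)
  | top (e : E) (t : unitInterval) : Glue Γ (squarePt e (t, 1)) (edgePt (Γ.label e) t)
  | left (e : E) (t : unitInterval) : Glue Γ (squarePt e (0, t)) (edgePt (Γ.src e) t)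
  | right (e : E) (t : unitInterval) : Glue Γ (squarePt e (1, t)) (edgePt (Γ.tgt e) t)

/-- The presentation 2-complex of a labeled oriented graph, with the quotient topology. -/
def Complex (Γ : LOG V E) : Type := Quot Γ.Glue

instance (Γ : LOG V E) : TopologicalSpace Γ.Complex :=
  inferInstanceAs (TopologicalSpace (Quot Γ.Glue))

/-- The characteristic map of the 1-cell of the generator `a`. -/
def edgeMap (Γ : LOG V E) (a : V) (t : unitInterval) : Γ.Complex := Quot.mk _ (edgePt a t)

/-- The characteristic map of the 2-cell of the relation `e`. -/
def squareMap (Γ : LOG V E) (e : E) (z : unitInterval × unitInterval) : Γ.Complex :=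
  Quot.mk _ (squarePt e z)

/-- The map `p` is the universal covering of the presentation complex. -/
def IsUniversalCover (Γ : LOG V E) {Y : Type*} [TopologicalSpace Y] (p : Y → Γ.Complex) : Prop :=
  IsCoveringMap p ∧ SimplyConnectedSpace Y

/-- The point of the Euclidean plane with the same coordinates. -/
def toPlane (z : unitInterval × unitInterval) : EuclideanSpace ℝ (Fin 2) := !₂[(z.1 : ℝ), (z.2 : ℝ)]

/-- The strings of a covering space `Y` of the presentation complex, with their lengths. The cells
of `Y` are the lifts `σ` of the characteristic maps. A string from `x` to `y` is a finite
sequence of points from `x` to `y`, any two consecutive ones of which lie in a common cell; its length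
is the sum of the Euclidean distances of consecutive points in these cells. -/
inductive IsString (Γ : LOG V E) {Y : Type*} [TopologicalSpace Y] (p : Y → Γ.Complex) (x : Y) :
    Y → NNReal → Prop
  | nil : IsString Γ p x x 0
  | edge (a : V) (σ : C(unitInterval, Y)) (hσ : ∀ t, p (σ t) = Γ.edgeMap a t)
      (s t : unitInterval) (l : NNReal) (h : IsString Γ p x (σ s) l) :
      IsString Γ p x (σ t) (l + nndist s t)
  | square (e : E) (σ : C(unitInterval × unitInterval, Y)) (hσ : ∀ z, p (σ z) = Γ.squareMap e z)
      (z w : unitInterval × unitInterval) (l : NNReal) (h : IsString Γ p x (σ z) l) :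
      IsString Γ p x (σ w) (l + nndist (toPlane z) (toPlane w))

/-- The intrinsic distance of the piecewise Euclidean 2-complex `Y`: the infimum of the lengths of the
strings from `x` to `y`. -/
noncomputable def cellDist (Γ : LOG V E) {Y : Type*} [TopologicalSpace Y] (p : Y → Γ.Complex)
    (x y : Y) : ENNReal :=
  ⨅ (l : NNReal) (_ : Γ.IsString p x y l), (l : ENNReal)

/-- The covering space `Y`, with its intrinsic distance, contains an isometrically embedded copy of the
Euclidean plane. -/
def HasFlatPlane (Γ : LOG V E) {Y : Type*} [TopologicalSpace Y] (p : Y → Γ.Complex) : Prop :=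
  ∃ f : EuclideanSpace ℝ (Fin 2) → Y, ∀ x y, Γ.cellDist p (f x) (f y) = edist x y

/-- A corner of a 2-cell: `(e, i, j)` is the corner of the square of `e` with coordinates `(i, j)`,
where `false` is the coordinate `0` and `true` is the coordinate `1`. -/
abbrev Corner (E : Type) : Type := E × Bool × Bool

/-- The ends in the link of the 0-cell of the link edge given by a corner. A vertex `(a, b)` of the
link is the germ of the 1-cell `a` at its start (`b = false`) or at its finish (`b = true`). At the
corner `(i, j)` the horizontal side is `label e` at its end `i`, and the vertical side
(`src e` on the left, `tgt e` on the right) is at its end `j`. -/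
def cornerEnds (Γ : LOG V E) (c : Corner E) : Sym2 (V × Bool) :=
  s((Γ.label c.1, c.2.1), (if c.2.1 then Γ.tgt c.1 else Γ.src c.1, c.2.2))

/-- The cyclic sequence of link vertices `v` and link edges `c` is a circuit of length four. -/
def IsFourCircuit (Γ : LOG V E) (v : Fin 4 → V × Bool) (c : Fin 4 → Corner E) : Prop :=
  Function.Injective v ∧ Function.Injective c ∧ ∀ i, Γ.cornerEnds (c i) = s(v i, v (i + 1))

/-- A poison corner: its edge in the link is not part of any circuit of length four. -/
def IsPoisonCorner (Γ : LOG V E) (c : Corner E) : Prop :=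
  ¬ ∃ (v : Fin 4 → V × Bool) (d : Fin 4 → Corner E), Γ.IsFourCircuit v d ∧ ∃ i, d i = c

/-- The labeled oriented tree on `a₀, …, a₄` with relations
`a₃ = a₀ a₄ a₀⁻¹`, `a₄ = a₁ a₀ a₁⁻¹`, `a₄ = a₂ a₁ a₂⁻¹`, `a₄ = a₃ a₂ a₃⁻¹` (in this order). -/
def fiveLOT : LOG (Fin 5) (Fin 4) where
  src := ![3, 4, 4, 4]
  tgt := ![4, 0, 1, 2]
  label := ![0, 1, 2, 3]

/-- The labeled oriented tree on `a₀, …, aₖ`, all of whose edges contain `aₖ`, with relations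
`aₖ = aᵢ aᵢ₋₁ aᵢ⁻¹` for `1 ≤ i ≤ k - 1` and `aₖ₋₁ = a₀ aₖ a₀⁻¹`; edge `i` is the one labeled `aᵢ`. -/
def starLOT (k : ℕ) : LOG (Fin (k + 1)) (Fin k) where
  src i := if i.val = 0 then ⟨k - 1, by omega⟩ else Fin.last k
  tgt i := if i.val = 0 then Fin.last k else ⟨i.val - 1, by omega⟩
  label i := i.castSucc

theorem starLOT_four : starLOT 4 = fiveLOT := by
  ext i <;> fin_cases i <;> rfl

end LOG

/-! A flat plane in a covering of such a square complex must be tiled by lifted unit squares, and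
four of them meet at every corner of a tile. In the link of the 0-cell these four corners form a
circuit of length four. So a single square on the plane has all of its corners on 4-circuits, and
one poison corner in every square rules the plane out.

The work lies in obtaining the tiling from an embedding `f` that is isometric only for the infimum
of string lengths. Around each point there is a radius (`Sep`) within which a string can be
straightened to one segment in a single square (`IsString.exists_square`). Hence `f` preserves the
distance from any point mapped to the interior of a square, as long as the target is near.
Polarization makes `f` affine there, and a connectedness argument spreads the chart over the whole
square (`exists_chart`). Some point is mapped to an open square, because a plane does not fit into a
graph (`exists_inner`). Looking just across a side of a tile gives the neighbouring tile
(`IsTile.pivot`), and turning around the corner gives the circuit (`IsTile.exists_fourCircuit`).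

The rest is a finite pattern in the link: each square has a corner with one end whose other
neighbours are only the two ends of the last generator, while no other neighbour of the opposite end
is adjacent to those (`starLOT_isPoisonCorner`). -/

namespace LOG

/-! ### Sides, corners and interior of the unit square. -/

open unitInterval in
/-- The parameter read from the start (`false`) or from the finish (`true`). -/
def flip (b : Bool) (t : I) : I := cond b (unitInterval.symm t) t

/-- The end `b` of the unit interval. -/
def bit (b : Bool) : unitInterval := cond b 1 0

/-- The point of parameter `t` on a side of the unit square. The sides are the pairs `(d, i)`:
horizontal at height `i` for `d = false`, vertical at abscissa `i` for `d = true`. -/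
def sidePt (S : Bool × Bool) (t : unitInterval) : unitInterval × unitInterval :=
  cond S.1 (bit S.2, t) (t, bit S.2)

/-- A point of the open unit square. -/
def IsInner (z : unitInterval × unitInterval) : Prop :=
  (z.1 ≠ 0 ∧ z.1 ≠ 1) ∧ z.2 ≠ 0 ∧ z.2 ≠ 1

/-- A corner of the unit square. -/
def IsVertex (z : unitInterval × unitInterval) : Prop :=
  (z.1 = 0 ∨ z.1 = 1) ∧ (z.2 = 0 ∨ z.2 = 1)

theorem isInner_or_isVertex_or_sidePt (z : unitInterval × unitInterval) :
    IsInner z ∨ IsVertex z ∨ ∃ S t, t ≠ 0 ∧ t ≠ 1 ∧ z = sidePt S t := by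
  obtain ⟨a, b⟩ := z
  by_cases h : IsInner (a, b)
  · exact Or.inl h
  by_cases h' : IsVertex (a, b)
  · exact Or.inr (Or.inl h')
  refine Or.inr (Or.inr ?_)
  simp only [IsInner, IsVertex] at h h'
  by_cases ha : a = 0
  · exact ⟨(true, false), b, by tauto, by tauto, by simp [sidePt, bit, ha]⟩
  by_cases ha' : a = 1
  · exact ⟨(true, true), b, by tauto, by tauto, by simp [sidePt, bit, ha']⟩
  by_cases hb : b = 0
  · exact ⟨(false, false), a, by tauto, by tauto, by simp [sidePt, bit, hb]⟩
  exact ⟨(false, true), a, by tauto, by tauto, by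
    have : b = 1 := by tauto
    simp [sidePt, bit, this]⟩

theorem continuous_sidePt (S : Bool × Bool) : Continuous (sidePt S) := by
  obtain ⟨d, i⟩ := S
  cases d
  · exact Continuous.prodMk_left (bit i)
  · exact Continuous.prodMk_right (bit i)

/-! ### Normal forms of points of the complex. -/

section

variable {V E : Type} (Γ : LOG V E)

/-- The generator along a side of the square of a relation. -/
def gen (e : E) (S : Bool × Bool) : V := cond S.1 (cond S.2 (Γ.tgt e) (Γ.src e)) (Γ.label e)

theorem squareMap_sidePt (e : E) (S : Bool × Bool) (t : unitInterval) :
    Γ.squareMap e (sidePt S t) = Γ.edgeMap (Γ.gen e S) t := by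
  obtain ⟨d, i⟩ := S
  cases d <;> cases i
  · exact Quot.sound (Glue.bottom e t)
  · exact Quot.sound (Glue.top e t)
  · exact Quot.sound (Glue.left e t)
  · exact Quot.sound (Glue.right e t)

theorem continuous_squareMap (e : E) : Continuous (Γ.squareMap e) := by
  refine continuous_quot_mk.comp ?_
  exact continuous_inr.comp (continuous_inr.comp (continuous_sigmaMk (σ := fun _ : E => unitInterval × unitInterval)))

open Classical in
/-- The normal form of a point of a 1-cell. -/
noncomputable def edgeNormal (a : V) (t : unitInterval) : Cells V E :=
  if t = 0 ∨ t = 1 then Sum.inl () else edgePt a t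

open Classical in
/-- The normal form of a point of a 2-cell: it lies in the open cell that contains the point. -/
noncomputable def squareNormal (e : E) (z : unitInterval × unitInterval) : Cells V E :=
  if z.2 = 0 ∨ z.2 = 1 then edgeNormal (Γ.label e) z.1
  else if z.1 = 0 then edgeNormal (Γ.src e) z.2
  else if z.1 = 1 then edgeNormal (Γ.tgt e) z.2
  else squarePt e z

/-- The normal form of a point of the complex. -/
noncomputable def normal : Γ.Complex → Cells V E :=
  Quot.lift (fun c : Cells V E => match c with
    | Sum.inl () => Sum.inl ()
    | Sum.inr (Sum.inl ⟨a, t⟩) => edgeNormal a t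
    | Sum.inr (Sum.inr ⟨e, z⟩) => Γ.squareNormal e z) <| by
    rintro _ _ (a | a | ⟨e, t⟩ | ⟨e, t⟩ | ⟨e, t⟩ | ⟨e, t⟩) <;>
      simp only [edgePt, squarePt, squareNormal, edgeNormal] <;> split_ifs <;> simp_all

theorem normal_edgeMap (a : V) (t : unitInterval) :
    Γ.normal (Γ.edgeMap a t) = edgeNormal a t := rfl

theorem normal_squareMap (e : E) (z : unitInterval × unitInterval) :
    Γ.normal (Γ.squareMap e z) = Γ.squareNormal e z := rfl

/-- `normal` is constant on glued points, so it separates points of the quotient without any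
description of the generated equivalence relation. The ends are excluded because all generators meet
there. -/
theorem edgeMap_inj {a b : V} {s t : unitInterval} (hs : s ≠ 0) (hs' : s ≠ 1)
    (h : Γ.edgeMap a s = Γ.edgeMap b t) : a = b ∧ s = t := by
  have := congrArg Γ.normal h
  rw [normal_edgeMap, normal_edgeMap, edgeNormal, edgeNormal, if_neg (by tauto)] at this
  split_ifs at this with ht
  · simp [edgePt] at this
  · simpa only [edgePt, Sum.inr.injEq, Sum.inl.injEq, Sigma.mk.injEq, heq_eq_eq] using this

theorem normal_inner {e : E} {z : unitInterval × unitInterval} (hz : IsInner z) :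
    Γ.normal (Γ.squareMap e z) = squarePt e z := by
  obtain ⟨⟨h1, h2⟩, h3, h4⟩ := hz
  simp [normal_squareMap, squareNormal, *]

theorem normal_vertex {e : E} {z : unitInterval × unitInterval} (hz : IsVertex z) :
    Γ.normal (Γ.squareMap e z) = Sum.inl () := by
  obtain ⟨h1, h2⟩ := hz
  simp [normal_squareMap, squareNormal, edgeNormal, *]

theorem normal_sidePt {e : E} {S : Bool × Bool} {t : unitInterval} (h0 : t ≠ 0) (h1 : t ≠ 1) :
    Γ.normal (Γ.squareMap e (sidePt S t)) = edgePt (Γ.gen e S) t := by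
  rw [squareMap_sidePt, normal_edgeMap, edgeNormal, if_neg (by tauto)]

/-- Two points of 2-cells with the same image lie in the same open cell, at the same place. -/
theorem squareMap_eq_cases {e e' : E} {w w' : unitInterval × unitInterval}
    (h : Γ.squareMap e w = Γ.squareMap e' w') :
    (IsInner w ∧ e = e' ∧ w = w') ∨ (IsVertex w ∧ IsVertex w') ∨
      ∃ S S' t, t ≠ 0 ∧ t ≠ 1 ∧ w = sidePt S t ∧ w' = sidePt S' t ∧ Γ.gen e S = Γ.gen e' S' := by
  have h := congrArg Γ.normal h
  rcases isInner_or_isVertex_or_sidePt w with hw | hw | ⟨S, t, h0, h1, rfl⟩ <;>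
  rcases isInner_or_isVertex_or_sidePt w' with hw' | hw' | ⟨S', t', h0', h1', rfl⟩
  · rw [normal_inner Γ hw, normal_inner Γ hw'] at h
    simp only [squarePt, Sum.inr.injEq, Sigma.mk.injEq, heq_eq_eq] at h
    exact Or.inl ⟨hw, h⟩
  · simp [normal_inner Γ hw, normal_vertex Γ hw', squarePt] at h
  · simp [normal_inner Γ hw, normal_sidePt Γ h0' h1', squarePt, edgePt] at h
  · simp [normal_inner Γ hw', normal_vertex Γ hw, squarePt] at h
  · exact Or.inr (Or.inl ⟨hw, hw'⟩)
  · simp [normal_vertex Γ hw, normal_sidePt Γ h0' h1', edgePt] at h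
  · simp [normal_inner Γ hw', normal_sidePt Γ h0 h1, squarePt, edgePt] at h
  · simp [normal_vertex Γ hw', normal_sidePt Γ h0 h1, edgePt] at h
  · rw [normal_sidePt Γ h0 h1, normal_sidePt Γ h0' h1'] at h
    simp only [edgePt, Sum.inr.injEq, Sum.inl.injEq, Sigma.mk.injEq, heq_eq_eq] at h
    exact Or.inr (Or.inr ⟨S, S', t, h0, h1, rfl, by rw [h.2], h.1⟩)

theorem squareMap_inj {e e' : E} {w w' : unitInterval × unitInterval} (hw : IsInner w)
    (h : Γ.squareMap e w = Γ.squareMap e' w') : e = e' ∧ w = w' := by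
  rcases squareMap_eq_cases Γ h with h | h | ⟨S, S', t, h0, h1, rfl, h⟩
  · exact h.2
  · obtain ⟨⟨h1, h2⟩, h3, h4⟩ := hw
    rcases h.1 with ⟨h | h, -⟩ <;> contradiction
  · obtain ⟨d, i⟩ := S
    exfalso
    revert hw
    cases d <;> cases i <;> simp [sidePt, bit, IsInner]

end

/-! ### Lifted cells of the covering space and how they meet. -/

/-- `σ` is a lift of the characteristic map of the 2-cell of `e`. -/
def IsLift {V E : Type} (Γ : LOG V E) {Y : Type*} [TopologicalSpace Y] (p : Y → Γ.Complex) (e : E)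
    (σ : C(unitInterval × unitInterval, Y)) : Prop :=
  ∀ z, p (σ z) = Γ.squareMap e z

variable {V E : Type} {Γ : LOG V E} {Y : Type*} [TopologicalSpace Y] {p : Y → Γ.Complex}

theorem IsLift.eq (hp : IsCoveringMap p) {e : E} {σ σ' : C(unitInterval × unitInterval, Y)}
    (h : Γ.IsLift p e σ) (h' : Γ.IsLift p e σ') {z : unitInterval × unitInterval}
    (hz : σ z = σ' z) : σ = σ' := by
  apply DFunLike.coe_injective
  exact hp.eq_of_comp_eq σ.continuous σ'.continuous
    (by funext z; simp [h z, h' z]) z hz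

theorem exists_isLift (hp : IsCoveringMap p) (e : E) (z : unitInterval × unitInterval) (y : Y)
    (hy : p y = Γ.squareMap e z) : ∃ σ, Γ.IsLift p e σ ∧ σ z = y := by
  -- The characteristic map is extended to the plane by the clamping retraction `ρ`, lifted there,
  -- and restricted to the square again.
  let ι : C(unitInterval × unitInterval, ℝ × ℝ) := ⟨fun z => (z.1, z.2), by fun_prop⟩
  let ρ : C(ℝ × ℝ, unitInterval × unitInterval) :=
    ⟨fun v => (Set.projIcc 0 1 zero_le_one v.1, Set.projIcc 0 1 zero_le_one v.2), by fun_prop⟩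
  have hρ : ∀ z, ρ (ι z) = z := fun z => by simp [ρ, ι]
  obtain ⟨F, ⟨h1, h2⟩, -⟩ := hp.existsUnique_continuousMap_lifts
    ((⟨_, Γ.continuous_squareMap e⟩ : C(_, Γ.Complex)).comp ρ) (ι z) y (by simpa [hρ] using hy)
  refine ⟨F.comp ι, fun z => ?_, h1⟩
  have := congrFun h2 (ι z)
  simpa [hρ] using this

/-- Lifts of a 1-cell that agree somewhere agree. -/
theorem edge_lift_eq (hp : IsCoveringMap p) {a : V} {τ τ' : unitInterval → Y}
    (hc : Continuous τ) (hc' : Continuous τ') (h : ∀ t, p (τ t) = Γ.edgeMap a t)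
    (h' : ∀ t, p (τ' t) = Γ.edgeMap a t) {t : unitInterval} (ht : τ t = τ' t) (s : unitInterval) :
    τ s = τ' s :=
  congrFun (hp.eq_of_comp_eq hc hc' (by funext z; simp [h z, h' z]) t ht) s

theorem IsLift.side_eq (hp : IsCoveringMap p) {e e' : E}
    {σ σ' : C(unitInterval × unitInterval, Y)} (h : Γ.IsLift p e σ) (h' : Γ.IsLift p e' σ')
    {S S' : Bool × Bool} (hg : Γ.gen e S = Γ.gen e' S') {t : unitInterval}
    (ht : σ (sidePt S t) = σ' (sidePt S' t)) (s : unitInterval) :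
    σ (sidePt S s) = σ' (sidePt S' s) :=
  edge_lift_eq (a := Γ.gen e S) hp (τ := fun s => σ (sidePt S s)) (τ' := fun s => σ' (sidePt S' s))
    (σ.continuous.comp (continuous_sidePt S)) (σ'.continuous.comp (continuous_sidePt S'))
    (fun t => by rw [h, squareMap_sidePt]) (fun t => by rw [h', squareMap_sidePt, hg]) ht s

/-- The ways in which lifts of 2-cells may meet. -/
theorem IsLift.eq_cases (hp : IsCoveringMap p) {e e' : E}
    {σ σ' : C(unitInterval × unitInterval, Y)} (h : Γ.IsLift p e σ) (h' : Γ.IsLift p e' σ')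
    {w w' : unitInterval × unitInterval} (hw : σ w = σ' w') :
    (IsInner w ∧ e = e' ∧ σ = σ' ∧ w = w') ∨ (IsVertex w ∧ IsVertex w') ∨
      ∃ S S' t, t ≠ 0 ∧ t ≠ 1 ∧ w = sidePt S t ∧ w' = sidePt S' t ∧
        Γ.gen e S = Γ.gen e' S' ∧ ∀ s, σ (sidePt S s) = σ' (sidePt S' s) := by
  rcases squareMap_eq_cases Γ ((h w).symm.trans ((congrArg p hw).trans (h' w'))) with
    ⟨h1, rfl, rfl⟩ | h1 | ⟨S, S', t, h0, h1, rfl, rfl, h2⟩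
  · exact Or.inl ⟨h1, rfl, h.eq hp h' hw, rfl⟩
  · exact Or.inr (Or.inl h1)
  · exact Or.inr (Or.inr ⟨S, S', t, h0, h1, rfl, rfl, h2, h.side_eq hp h' h2 hw⟩)

theorem IsLift.inner_eq (hp : IsCoveringMap p) {e e' : E}
    {σ σ' : C(unitInterval × unitInterval, Y)} (h : Γ.IsLift p e σ) (h' : Γ.IsLift p e' σ')
    {w w' : unitInterval × unitInterval} (hw : σ w = σ' w') (hi : IsInner w) :
    e = e' ∧ σ = σ' ∧ w = w' := by
  obtain ⟨rfl, rfl⟩ := squareMap_inj Γ hi ((h w).symm.trans ((congrArg p hw).trans (h' w')))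
  exact ⟨rfl, h.eq hp h' hw, rfl⟩

/-- Every point lies on a lift of a 2-cell if every generator lies on a side of a 2-cell. -/
theorem exists_isLift_mem (hp : IsCoveringMap p) [Nonempty E] (hc : ∀ a, ∃ e S, Γ.gen e S = a)
    (y : Y) : ∃ e σ z, Γ.IsLift p e σ ∧ σ z = y := by
  suffices h : ∀ x : Γ.Complex, ∃ e z, x = Γ.squareMap e z by
    obtain ⟨e, z, h⟩ := h (p y)
    obtain ⟨σ, h⟩ := exists_isLift hp e z y h
    exact ⟨e, σ, z, h⟩
  have he : ∀ a t, ∃ e z, Γ.edgeMap a t = Γ.squareMap e z := fun a t => by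
    obtain ⟨e, S, rfl⟩ := hc a
    exact ⟨e, sidePt S t, (squareMap_sidePt Γ e S t).symm⟩
  rintro ⟨⟨⟩ | ⟨a, t⟩ | ⟨e, z⟩⟩
  · obtain ⟨e⟩ := ‹Nonempty E›
    obtain ⟨e', z, h⟩ := he (Γ.label e) 0
    exact ⟨e', z, (Quot.sound (Glue.start (Γ.label e))).symm.trans h⟩
  · exact he a t
  · exact ⟨e, z, rfl⟩

/-! ### Separation radii and the straightening of short strings. -/

/-- The coordinates of `z` that do not vanish are at least `r`, and so are their distances from `1`
when these do not vanish. -/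
def Sep (z : unitInterval × unitInterval) (r : ℝ) : Prop :=
  ((z.1 = 0 ∨ r ≤ z.1) ∧ (z.1 = 1 ∨ r ≤ 1 - z.1)) ∧ (z.2 = 0 ∨ r ≤ z.2) ∧ (z.2 = 1 ∨ r ≤ 1 - z.2)

theorem sep_of_le {z : unitInterval × unitInterval} {r s : ℝ} (h : Sep z r) (hs : s ≤ r) :
    Sep z s :=
  ⟨⟨h.1.1.imp_right hs.trans, h.1.2.imp_right hs.trans⟩,
    h.2.1.imp_right hs.trans, h.2.2.imp_right hs.trans⟩

theorem exists_sep_coord (t : unitInterval) :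
    ∃ r : ℝ, 0 < r ∧ (t = 0 ∨ r ≤ t) ∧ (t = 1 ∨ r ≤ 1 - t) := by
  by_cases h0 : t = 0
  · exact ⟨1, one_pos, Or.inl h0, Or.inr (by simp [h0])⟩
  by_cases h1 : t = 1
  · exact ⟨1, one_pos, Or.inr (by simp [h1]), Or.inl h1⟩
  have h0' : 0 < (t : ℝ) := unitInterval.coe_pos.2 (unitInterval.pos_iff_ne_zero.2 h0)
  have h1' : (t : ℝ) < 1 := unitInterval.coe_lt_one.2 (unitInterval.lt_one_iff_ne_one.2 h1)
  exact ⟨min t (1 - t), lt_min h0' (by linarith), Or.inr (min_le_left _ _), Or.inr (min_le_right _ _)⟩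

theorem exists_sep (z : unitInterval × unitInterval) : ∃ r : ℝ, 0 < r ∧ r ≤ 1 ∧ Sep z r := by
  obtain ⟨r, hr, h⟩ := exists_sep_coord z.1
  obtain ⟨s, hs, h'⟩ := exists_sep_coord z.2
  refine ⟨min (min r s) 1, lt_min (lt_min hr hs) one_pos, min_le_right _ _, ?_⟩
  have h1 : min (min r s) 1 ≤ r := (min_le_left _ _).trans (min_le_left _ _)
  have h2 : min (min r s) 1 ≤ s := (min_le_left _ _).trans (min_le_right _ _)
  exact ⟨⟨h.1.imp_right h1.trans, h.2.imp_right h1.trans⟩,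
    h'.1.imp_right h2.trans, h'.2.imp_right h2.trans⟩

theorem dist_toPlane_sq (z w : unitInterval × unitInterval) :
    dist (toPlane z) (toPlane w) ^ 2 = ((z.1 : ℝ) - w.1) ^ 2 + ((z.2 : ℝ) - w.2) ^ 2 := by
  rw [EuclideanSpace.dist_eq, Real.sq_sqrt (by positivity)]
  simp [toPlane, Real.dist_eq]

theorem toPlane_injective : Function.Injective toPlane := by
  intro z w h
  have h1 := congrArg (fun v => v 0) h
  have h2 := congrArg (fun v => v 1) h
  simp only [toPlane, PiLp.toLp_apply, Matrix.cons_val_zero, Matrix.cons_val_one] at h1 h2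
  exact Prod.ext (Subtype.ext h1) (Subtype.ext h2)

theorem abs_sub_fst_le (z w : unitInterval × unitInterval) :
    |(z.1 : ℝ) - w.1| ≤ dist (toPlane z) (toPlane w) :=
  abs_le_of_sq_le_sq (by nlinarith [dist_toPlane_sq z w, sq_nonneg ((z.2 : ℝ) - w.2)]) dist_nonneg

theorem abs_sub_snd_le (z w : unitInterval × unitInterval) :
    |(z.2 : ℝ) - w.2| ≤ dist (toPlane z) (toPlane w) :=
  abs_le_of_sq_le_sq (by nlinarith [dist_toPlane_sq z w, sq_nonneg ((z.1 : ℝ) - w.1)]) dist_nonneg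

theorem dist_sidePt (S : Bool × Bool) (s t : unitInterval) :
    dist (toPlane (sidePt S s)) (toPlane (sidePt S t)) = |(s : ℝ) - t| := by
  rw [← abs_of_nonneg (dist_nonneg (x := toPlane (sidePt S s)) (y := toPlane (sidePt S t))),
    ← sq_eq_sq_iff_abs_eq_abs, dist_toPlane_sq]
  obtain ⟨d, i⟩ := S
  cases d <;> simp [sidePt]

/-- A point near `z` lies on a side only if `z` does. -/
theorem Sep.faces {z w : unitInterval × unitInterval} {r : ℝ} (h : Sep z r)
    (hd : dist (toPlane z) (toPlane w) < r) :
    ((w.1 = 0 → z.1 = 0) ∧ (w.1 = 1 → z.1 = 1)) ∧ (w.2 = 0 → z.2 = 0) ∧ (w.2 = 1 → z.2 = 1) := by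
  have h1 := abs_le.1 ((abs_sub_fst_le z w).trans hd.le)
  have h2 := abs_lt.1 ((abs_sub_fst_le z w).trans_lt hd)
  have h3 := abs_lt.1 ((abs_sub_snd_le z w).trans_lt hd)
  refine ⟨⟨fun hw => h.1.1.resolve_right fun h => ?_, fun hw => h.1.2.resolve_right fun h => ?_⟩,
    fun hw => h.2.1.resolve_right fun h => ?_, fun hw => h.2.2.resolve_right fun h => ?_⟩ <;>
  simp only [hw, Set.Icc.coe_zero, Set.Icc.coe_one] at h2 h3 <;> linarith

theorem Sep.inner {z w : unitInterval × unitInterval} {r : ℝ} (h : Sep z r)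
    (hd : dist (toPlane z) (toPlane w) < r) (hz : IsInner z) : IsInner w := by
  have := h.faces hd
  simp only [IsInner] at *
  tauto

theorem Sep.vertex {z w : unitInterval × unitInterval} {r : ℝ} (h : Sep z r)
    (hd : dist (toPlane z) (toPlane w) < r) (hw : IsVertex w) : z = w := by
  obtain ⟨⟨h1, h2⟩, h3, h4⟩ := h.faces hd
  refine Prod.ext ?_ ?_
  · rcases hw.1 with h | h
    · rw [h, h1 h]
    · rw [h, h2 h]
  · rcases hw.2 with h | h
    · rw [h, h3 h]
    · rw [h, h4 h]

theorem Sep.side {z : unitInterval × unitInterval} {r : ℝ} (h : Sep z r) {S : Bool × Bool}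
    {t : unitInterval} (hd : dist (toPlane z) (toPlane (sidePt S t)) < r) :
    ∃ s, z = sidePt S s := by
  obtain ⟨⟨h1, h2⟩, h3, h4⟩ := h.faces hd
  obtain ⟨d, i⟩ := S
  cases d
  · refine ⟨z.1, Prod.ext rfl ?_⟩
    cases i
    · exact h3 rfl
    · exact h4 rfl
  · refine ⟨z.2, Prod.ext ?_ rfl⟩
    cases i
    · exact h1 rfl
    · exact h2 rfl

theorem sidePt_eq {S S' : Bool × Bool} {t s : unitInterval} (h0 : t ≠ 0) (h1 : t ≠ 1)
    (h : sidePt S t = sidePt S' s) : S = S' ∧ t = s := by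
  obtain ⟨d, i⟩ := S
  obtain ⟨d', i'⟩ := S'
  cases d <;> cases d' <;> cases i <;> cases i' <;> simp_all [sidePt, bit]

theorem sep_sidePt {S : Bool × Bool} {t : unitInterval} {r : ℝ} (h0 : r ≤ t) (h1 : r ≤ 1 - t) :
    Sep (sidePt S t) r := by
  obtain ⟨d, i⟩ := S
  have : r ≤ 1 := by linarith [t.2.1]
  cases d <;> cases i <;> simp_all [sidePt, bit, Sep]

theorem Sep.of_sidePt {S : Bool × Bool} {t : unitInterval} {r : ℝ} (h : Sep (sidePt S t) r)
    (h0 : t ≠ 0) (h1 : t ≠ 1) : r ≤ t ∧ r ≤ 1 - t := by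
  obtain ⟨d, i⟩ := S
  cases d
  · exact ⟨h.1.1.resolve_left h0, h.1.2.resolve_left h1⟩
  · exact ⟨h.2.1.resolve_left h0, h.2.2.resolve_left h1⟩

theorem sep_vertex {z : unitInterval × unitInterval} {r : ℝ} (hr : r ≤ 1) (h : IsVertex z) :
    Sep z r := by
  obtain ⟨h1 | h1, h2 | h2⟩ := h <;> simp [Sep, h1, h2, hr]

/-- Sides are glued with equal parameters, so the separation of a point does not depend on the
square in which it is read. A corner may be glued to any corner, and corners are separated up to
`1`; this is where `r ≤ 1` enters. -/
theorem IsLift.sep (hp : IsCoveringMap p) {e e' : E}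
    {σ σ' : C(unitInterval × unitInterval, Y)} (h : Γ.IsLift p e σ) (h' : Γ.IsLift p e' σ')
    {w w' : unitInterval × unitInterval} (hw : σ w = σ' w') {r : ℝ} (hr : r ≤ 1) (hs : Sep w r) :
    Sep w' r := by
  rcases h.eq_cases hp h' hw with ⟨-, -, -, rfl⟩ | hv | ⟨S, S', t, h0, h1, rfl, rfl, -⟩
  · exact hs
  · exact sep_vertex hr hv.2
  · exact sep_sidePt (hs.of_sidePt h0 h1).1 (hs.of_sidePt h0 h1).2

/-- A point near `σ z` in the 2-cell `σ` has the same position relative to `σ z` in every 2-cell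
that contains it. -/
theorem IsLift.move (hp : IsCoveringMap p) {e e' : E}
    {σ σ' : C(unitInterval × unitInterval, Y)} (h : Γ.IsLift p e σ) (h' : Γ.IsLift p e' σ')
    {z w w' : unitInterval × unitInterval} {r : ℝ} (hs : Sep z r)
    (hd : dist (toPlane z) (toPlane w) < r) (hw : σ w = σ' w') :
    ∃ z', σ' z' = σ z ∧ dist (toPlane z') (toPlane w') = dist (toPlane z) (toPlane w) := by
  rcases h.eq_cases hp h' hw with ⟨-, -, rfl, rfl⟩ | hv | ⟨S, S', t, h0, h1, rfl, rfl, -, h2⟩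
  · exact ⟨z, rfl, rfl⟩
  · obtain rfl := hs.vertex hd hv.1
    exact ⟨w', hw.symm, by simp⟩
  · obtain ⟨s, rfl⟩ := hs.side hd
    exact ⟨sidePt S' s, (h2 s).symm, by simp [dist_sidePt]⟩

/-- Different corners, or different sides, of one lift have not been shown to be disjoint in `Y`, so
injectivity is asserted only within the separation radius. -/
theorem IsLift.inj (hp : IsCoveringMap p) {e : E}
    {σ : C(unitInterval × unitInterval, Y)} (h : Γ.IsLift p e σ)
    {z w : unitInterval × unitInterval} {r : ℝ} (hs : Sep z r)
    (hd : dist (toPlane z) (toPlane w) < r) (hw : σ z = σ w) : z = w := by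
  rcases h.eq_cases hp h hw with ⟨-, -, -, h⟩ | hv | ⟨S, S', t, h0, h1, rfl, rfl, -⟩
  · exact h
  · exact hs.vertex hd hv.2
  · obtain ⟨s, hs⟩ := hs.side hd
    rw [(sidePt_eq h0 h1 hs).1]

/-- The end of a short string from `σ₀ z₀` lies in a common 2-cell with `σ₀ z₀`. -/
theorem IsString.exists_square (hp : IsCoveringMap p) (hc : ∀ a, ∃ e S, Γ.gen e S = a) {e₀ : E}
    {σ₀ : C(unitInterval × unitInterval, Y)} (h₀ : Γ.IsLift p e₀ σ₀)
    {z₀ : unitInterval × unitInterval} {r : ℝ} (hr : r ≤ 1) (hs : Sep z₀ r) {y : Y} {l : NNReal}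
    (hl : Γ.IsString p (σ₀ z₀) y l) (hlr : (l : ℝ) < r) :
    ∃ e σ z w, Γ.IsLift p e σ ∧ σ z = σ₀ z₀ ∧ σ w = y ∧ dist (toPlane z) (toPlane w) ≤ l := by
  -- One more segment inside `σ`: by `IsLift.move` the starting point also lies in `σ`, at the same
  -- distance from the old endpoint, so the triangle inequality in `σ` bounds its distance from the
  -- new one.
  have key : ∀ {e : E} {σ : C(unitInterval × unitInterval, Y)}, Γ.IsLift p e σ →
      ∀ {z w : unitInterval × unitInterval} {l : NNReal}, (l : ℝ) < r →
      (∃ e σ' z' w', Γ.IsLift p e σ' ∧ σ' z' = σ₀ z₀ ∧ σ' w' = σ z ∧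
        dist (toPlane z') (toPlane w') ≤ l) →
      ∃ e σ' z' w', Γ.IsLift p e σ' ∧ σ' z' = σ₀ z₀ ∧ σ' w' = σ w ∧
        dist (toPlane z') (toPlane w') ≤ l + dist (toPlane z) (toPlane w) := by
    rintro e σ h z w l hl ⟨e', σ', z', w', h', hz', hw', hd⟩
    obtain ⟨z'', h1, h2⟩ :=
      h'.move hp h (h₀.sep hp h' hz'.symm hr hs) (hd.trans_lt hl) hw'
    refine ⟨e, σ, z'', w, h, h1.trans hz', rfl, (dist_triangle _ (toPlane z) _).trans ?_⟩
    rw [h2]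
    linarith
  induction hl with
  | nil => exact ⟨e₀, σ₀, z₀, z₀, h₀, rfl, rfl, by simp⟩
  | edge a τ hτ s t l _ ih =>
    push_cast at hlr ⊢
    have hl : (l : ℝ) < r := by linarith [dist_nonneg (x := s) (y := t)]
    obtain ⟨e, S, rfl⟩ := hc a
    obtain ⟨σ, h, hσ⟩ := exists_isLift hp e (sidePt S s) (τ s)
      (by rw [hτ, squareMap_sidePt])
    have hst := edge_lift_eq (a := Γ.gen e S) hp (τ' := fun s => σ (sidePt S s)) τ.continuous
      (σ.continuous.comp (continuous_sidePt S)) hτ (fun t => by rw [h, squareMap_sidePt]) hσ.symm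
    have := key h (w := sidePt S t) hl (by rw [hσ]; exact ih hl)
    rw [dist_sidePt, ← Real.dist_eq, ← hst t] at this
    exact this
  | square e σ h z w l _ ih =>
    push_cast at hlr ⊢
    have hl : (l : ℝ) < r := by linarith [dist_nonneg (x := toPlane z) (y := toPlane w)]
    exact key h hl (ih hl)

/-- Points joined by arbitrarily short strings are equal. -/
theorem eq_of_short_strings (hp : IsCoveringMap p) [Nonempty E] (hc : ∀ a, ∃ e S, Γ.gen e S = a)
    {x y : Y} (h : ∀ ε > 0, ∃ l : NNReal, (l : ℝ) < ε ∧ Γ.IsString p x y l) : x = y := by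
  obtain ⟨e₀, σ₀, z₀, h₀, rfl⟩ := exists_isLift_mem hp hc x
  obtain ⟨e, σ, w, h', rfl⟩ := exists_isLift_mem hp hc y
  obtain ⟨r, hr, hr1, hs⟩ := exists_sep z₀
  -- The preimage `z` of `x` in the fixed square `σ` may depend on `ε`, but two preimages within the
  -- separation radius coincide. So one `z` serves all small `ε`, and it is `w`.
  have key : ∀ ε > 0, ∃ z, σ z = σ₀ z₀ ∧ dist (toPlane z) (toPlane w) < ε := by
    intro ε hε
    obtain ⟨l, hl, hl'⟩ := h (min ε r) (lt_min hε hr)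
    have hlr := hl.trans_le (min_le_right _ _)
    obtain ⟨e', σ', z', w', h'', hz', hw', hd⟩ := hl'.exists_square hp hc h₀ hr1 hs hlr
    obtain ⟨z, hz, hz'⟩ := h''.move hp h' (h₀.sep hp h'' hz'.symm hr1 hs) (hd.trans_lt hlr) hw'
    exact ⟨z, hz.trans ‹_›, by rw [‹dist _ _ = _›]; exact hd.trans_lt (hl.trans_le (min_le_left _ _))⟩
  obtain ⟨z, hz, hzd⟩ := key (r / 2) (by linarith)
  have : dist (toPlane z) (toPlane w) ≤ 0 := by
    refine le_of_forall_pos_lt_add fun ε hε => ?_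
    obtain ⟨z', hz', hzd'⟩ := key (min ε (r / 2)) (lt_min hε (by linarith))
    have h2 := hzd'.trans_le (min_le_right _ _)
    have : z = z' := h'.inj hp (h₀.sep hp h' hz.symm hr1 hs)
      ((dist_triangle_right _ _ (toPlane w)).trans_lt (by linarith)) (hz.trans hz'.symm)
    rw [this, zero_add]
    exact hzd'.trans_le (min_le_left _ _)
  rw [← hz, toPlane_injective (dist_le_zero.1 this)]

/-! ### Euclidean charts of the squares met by the plane. -/

open Filter Topology

/-- The bisector of two distinct points has empty interior: moving `u` in the direction `a - b`
changes the difference of the squared distances. -/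
theorem eq_of_equidistant {F : Type*} [NormedAddCommGroup F] [InnerProductSpace ℝ F] {U : Set F}
    (hU : IsOpen U) (hne : U.Nonempty) {a b : F} (h : ∀ u ∈ U, dist u a = dist u b) : a = b := by
  obtain ⟨u, hu⟩ := hne
  have hc : Tendsto (fun t : ℝ => u + t • (a - b)) (𝓝[>] 0) (𝓝 u) := by
    have : Continuous fun t : ℝ => u + t • (a - b) := by fun_prop
    simpa using (this.tendsto 0).mono_left nhdsWithin_le_nhds
  obtain ⟨t, htU, ht⟩ :=
    ((hc.eventually (hU.mem_nhds hu)).and (self_mem_nhdsWithin : Set.Ioi (0 : ℝ) ∈ 𝓝[>] 0)).exists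
  have h1 := h u hu
  have h2 := h _ htU
  rw [dist_eq_norm, dist_eq_norm] at h1 h2
  have e1 : u + t • (a - b) - a = (u - a) + t • (a - b) := by abel
  have e2 : u + t • (a - b) - b = (u - b) + t • (a - b) := by abel
  have h3 := congrArg (· ^ 2) h2
  simp only [e1, e2, norm_add_sq_real, h1] at h3
  have h4 : inner ℝ (u - a) (t • (a - b)) = inner ℝ (u - b) (t • (a - b)) := by linarith
  rw [inner_smul_right, inner_smul_right] at h4
  have h5 := mul_left_cancel₀ (ne_of_gt ht) h4
  have h6 : inner ℝ ((u - b) - (u - a)) (a - b) = 0 := by rw [inner_sub_left, h5, sub_self]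
  rw [sub_sub_sub_cancel_left, inner_self_eq_zero] at h6
  exact sub_eq_zero.1 h6

/-- The point of the unit square closest to a point of the plane. -/
noncomputable def toSquare (v : EuclideanSpace ℝ (Fin 2)) : unitInterval × unitInterval :=
  (Set.projIcc 0 1 zero_le_one (v 0), Set.projIcc 0 1 zero_le_one (v 1))

@[simp] theorem toSquare_toPlane (z : unitInterval × unitInterval) : toSquare (toPlane z) = z := by
  simp [toSquare, toPlane]

/-- The open unit square in the plane. -/
def openSquare : Set (EuclideanSpace ℝ (Fin 2)) := {v | ∀ i, v i ∈ Set.Ioo (0 : ℝ) 1}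

theorem isOpen_openSquare : IsOpen openSquare := by
  simp only [openSquare, Set.ofPred_forall]
  exact isOpen_iInter_of_finite fun i => isOpen_Ioo.preimage (by fun_prop)

theorem isPreconnected_openSquare : IsPreconnected openSquare := by
  have : openSquare = ⋂ i : Fin 2, {v : EuclideanSpace ℝ (Fin 2) | v i ∈ Set.Ioo (0 : ℝ) 1} := by
    ext; simp [openSquare]
  rw [this]
  exact (convex_iInter fun i => (convex_Ioo (0 : ℝ) 1).linear_preimage
    (EuclideanSpace.proj (𝕜 := ℝ) i).toLinearMap).isPreconnected

theorem mem_openSquare_iff {v : EuclideanSpace ℝ (Fin 2)} :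
    v ∈ openSquare ↔ ∃ z, IsInner z ∧ toPlane z = v := by
  constructor
  · intro h
    have h0 := h 0
    have h1 := h 1
    refine ⟨(⟨v 0, h0.1.le, h0.2.le⟩, ⟨v 1, h1.1.le, h1.2.le⟩), ⟨⟨?_, ?_⟩, ?_, ?_⟩, ?_⟩
    · exact fun h => h0.1.ne' (congrArg Subtype.val h)
    · exact fun h => h0.2.ne (congrArg Subtype.val h)
    · exact fun h => h1.1.ne' (congrArg Subtype.val h)
    · exact fun h => h1.2.ne (congrArg Subtype.val h)
    · ext i
      fin_cases i <;> rfl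
  · rintro ⟨z, ⟨⟨h1, h2⟩, h3, h4⟩, rfl⟩ i
    fin_cases i
    · exact ⟨unitInterval.coe_pos.2 (unitInterval.pos_iff_ne_zero.2 h1),
        unitInterval.coe_lt_one.2 (unitInterval.lt_one_iff_ne_one.2 h2)⟩
    · exact ⟨unitInterval.coe_pos.2 (unitInterval.pos_iff_ne_zero.2 h3),
        unitInterval.coe_lt_one.2 (unitInterval.lt_one_iff_ne_one.2 h4)⟩

theorem toPlane_mem_closure_openSquare (z : unitInterval × unitInterval) :
    toPlane z ∈ closure openSquare := by
  let m : EuclideanSpace ℝ (Fin 2) := !₂[(1 / 2 : ℝ), 1 / 2]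
  have hc : Tendsto (fun t : ℝ => toPlane z + t • (m - toPlane z)) (𝓝[>] 0) (𝓝 (toPlane z)) := by
    have : Continuous fun t : ℝ => toPlane z + t • (m - toPlane z) := by fun_prop
    simpa using (this.tendsto 0).mono_left nhdsWithin_le_nhds
  refine mem_closure_of_tendsto hc ?_
  filter_upwards [Ioo_mem_nhdsGT (show (0 : ℝ) < 1 by norm_num)] with t ht i
  have key : ∀ s : unitInterval, (s : ℝ) + t * (1 / 2 - s) ∈ Set.Ioo (0 : ℝ) 1 := by
    intro s
    constructor <;> nlinarith [ht.1, ht.2, s.2.1, s.2.2, mul_nonneg s.2.1 (sub_nonneg.2 ht.2.le),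
      mul_nonneg (sub_nonneg.2 s.2.2) (sub_nonneg.2 ht.2.le)]
  fin_cases i
  · simpa [toPlane, m] using key z.1
  · simpa [toPlane, m] using key z.2

theorem Sep.shift {z w : unitInterval × unitInterval} {r d : ℝ} (h : Sep z r) (hz : IsInner z)
    (hd : dist (toPlane z) (toPlane w) ≤ d) : Sep w (r - d) := by
  obtain ⟨⟨h1, h2⟩, h3, h4⟩ := hz
  have a1 := abs_le.1 ((abs_sub_fst_le z w).trans hd)
  have a2 := abs_le.1 ((abs_sub_snd_le z w).trans hd)
  refine ⟨⟨Or.inr ?_, Or.inr ?_⟩, Or.inr ?_, Or.inr ?_⟩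
  · linarith [h.1.1.resolve_left h1]
  · linarith [h.1.2.resolve_left h2]
  · linarith [h.2.1.resolve_left h3]
  · linarith [h.2.2.resolve_left h4]

variable {f : EuclideanSpace ℝ (Fin 2) → Y}

theorem flat_injective (hf : ∀ x y, Γ.cellDist p (f x) (f y) = edist x y) :
    Function.Injective f := by
  intro x y h
  have h1 : Γ.cellDist p (f x) (f y) ≤ (0 : NNReal) := by
    rw [← h]
    exact iInf₂_le 0 IsString.nil
  rw [hf] at h1
  exact edist_le_zero.1 (by simpa using h1)

theorem exists_string (hf : ∀ x y, Γ.cellDist p (f x) (f y) = edist x y)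
    {x y : EuclideanSpace ℝ (Fin 2)} {ε : ℝ} (h : dist x y < ε) :
    ∃ l : NNReal, (l : ℝ) < ε ∧ Γ.IsString p (f x) (f y) l := by
  have hε : 0 < ε := dist_nonneg.trans_lt h
  have h1 : Γ.cellDist p (f x) (f y) < ENNReal.ofReal ε := by
    rw [hf, edist_dist]
    exact (ENNReal.ofReal_lt_ofReal_iff hε).2 h
  simp only [cellDist, iInf_lt_iff] at h1
  obtain ⟨l, hl, hl'⟩ := h1
  refine ⟨l, ?_, hl⟩
  rw [← ENNReal.ofReal_coe_nnreal] at hl'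
  exact (ENNReal.ofReal_lt_ofReal_iff hε).1 hl'

/-- A single segment is a string. This holds at every scale, whereas the reverse inequality needs
points that are close. -/
theorem dist_le_of_square (hf : ∀ x y, Γ.cellDist p (f x) (f y) = edist x y) {e : E}
    {σ : C(unitInterval × unitInterval, Y)} (h : Γ.IsLift p e σ)
    {x y : EuclideanSpace ℝ (Fin 2)} {z w : unitInterval × unitInterval} (hx : f x = σ z)
    (hy : f y = σ w) : dist x y ≤ dist (toPlane z) (toPlane w) := by
  have h1 : Γ.cellDist p (f x) (f y) ≤ (0 + nndist (toPlane z) (toPlane w) : NNReal) := by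
    rw [hx, hy]
    exact iInf₂_le _ (IsString.square e σ h z w 0 IsString.nil)
  rw [hf, zero_add, edist_nndist, ENNReal.coe_le_coe] at h1
  exact_mod_cast h1

theorem exists_square_of_dist_lt (hp : IsCoveringMap p) (hc : ∀ a, ∃ e S, Γ.gen e S = a)
    (hf : ∀ x y, Γ.cellDist p (f x) (f y) = edist x y) {e₀ : E}
    {σ₀ : C(unitInterval × unitInterval, Y)} (h₀ : Γ.IsLift p e₀ σ₀)
    {z₀ : unitInterval × unitInterval} {r : ℝ} (hr : r ≤ 1) (hs : Sep z₀ r)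
    {x y : EuclideanSpace ℝ (Fin 2)} (hx : f x = σ₀ z₀) {ε : ℝ} (hε : ε ≤ r)
    (hxy : dist x y < ε) :
    ∃ e σ z w, Γ.IsLift p e σ ∧ σ z = f x ∧ σ w = f y ∧ dist (toPlane z) (toPlane w) < ε := by
  obtain ⟨l, hl, hl'⟩ := exists_string hf hxy
  rw [hx] at hl'
  obtain ⟨e, σ, z, w, h, h1, h2, h3⟩ := hl'.exists_square hp hc h₀ hr hs (hl.trans_le hε)
  exact ⟨e, σ, z, w, h, h1.trans hx.symm, h2, h3.trans_lt hl⟩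

/-- Near a point of the plane that is mapped into an open square, the map preserves the distance
from that point. -/
theorem exists_inner_of_dist_lt (hp : IsCoveringMap p) (hc : ∀ a, ∃ e S, Γ.gen e S = a)
    (hf : ∀ x y, Γ.cellDist p (f x) (f y) = edist x y) {e : E}
    {σ : C(unitInterval × unitInterval, Y)} (h : Γ.IsLift p e σ)
    {z : unitInterval × unitInterval} {r : ℝ} (hr : r ≤ 1) (hs : Sep z r) (hz : IsInner z)
    {x y : EuclideanSpace ℝ (Fin 2)} (hx : f x = σ z) (hxy : dist x y < r) :
    ∃ w, IsInner w ∧ f y = σ w ∧ dist (toPlane z) (toPlane w) = dist x y := by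
  have key : ∀ ε ≤ r, dist x y < ε →
      ∃ w, σ w = f y ∧ IsInner w ∧ dist (toPlane z) (toPlane w) < ε := by
    intro ε hε hxy
    obtain ⟨e', σ', z', w, h', h1, h2, h3⟩ := exists_square_of_dist_lt hp hc hf h hr hs hx hε hxy
    obtain ⟨-, rfl, rfl⟩ := h.inner_eq hp h' (hx.symm.trans h1.symm) hz
    exact ⟨w, h2, hs.inner (h3.trans_le hε) hz, h3⟩
  obtain ⟨w, h1, h2, h3⟩ := key r le_rfl hxy
  -- The infimum of string lengths need not be attained a priori. Each `ε` yields its own position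
  -- for `f y`, but an inner point has only one position.
  refine ⟨w, h2, h1.symm, le_antisymm (le_of_forall_gt_imp_ge_of_dense fun ε hε => ?_)
    (dist_le_of_square hf h hx h1.symm)⟩
  obtain ⟨w', h1', h2', h3'⟩ := key (min ε r) (min_le_right _ _) (lt_min hε hxy)
  obtain ⟨-, -, rfl⟩ := h.inner_eq hp h (h1.trans h1'.symm) h2
  exact (h3'.trans_le (min_le_left _ _)).le

theorem dist_eq_of_inner (hp : IsCoveringMap p) (hc : ∀ a, ∃ e S, Γ.gen e S = a)
    (hf : ∀ x y, Γ.cellDist p (f x) (f y) = edist x y) {e : E}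
    {σ : C(unitInterval × unitInterval, Y)} (h : Γ.IsLift p e σ)
    {z w : unitInterval × unitInterval} {r : ℝ} (hr : r ≤ 1) (hs : Sep z r) (hz : IsInner z)
    {x y : EuclideanSpace ℝ (Fin 2)} (hx : f x = σ z) (hxy : dist x y < r) (hy : f y = σ w) :
    dist (toPlane z) (toPlane w) = dist x y := by
  obtain ⟨w', h1, h2, h3⟩ := exists_inner_of_dist_lt hp hc hf h hr hs hz hx hxy
  obtain ⟨-, -, rfl⟩ := h.inner_eq hp h (h2.symm.trans hy) h1
  exact h3

theorem inner_eq_inner_of_norm_eq {F : Type*} [NormedAddCommGroup F] [InnerProductSpace ℝ F]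
    {a b c d : F} (h₁ : ‖a‖ = ‖c‖) (h₂ : ‖b‖ = ‖d‖) (h₃ : ‖a - b‖ = ‖c - d‖) :
    inner ℝ a b = inner ℝ c d := by
  have h := congrArg (· ^ 2) h₃
  simp only [norm_sub_sq_real, h₁, h₂] at h
  linarith

/-- If `f ∘ B` is the lifted square `σ` on an open set, then also at the points so close to it that
the boundary of the square is farther away. -/
theorem extend_chart (hp : IsCoveringMap p) (hc : ∀ a, ∃ e S, Γ.gen e S = a)
    (hf : ∀ x y, Γ.cellDist p (f x) (f y) = edist x y) {e : E}
    {σ : C(unitInterval × unitInterval, Y)} (h : Γ.IsLift p e σ)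
    {B : EuclideanSpace ℝ (Fin 2) → EuclideanSpace ℝ (Fin 2)} (hB : Isometry B)
    {U : Set (EuclideanSpace ℝ (Fin 2))} (hU : IsOpen U) (hne : U.Nonempty) (hUo : U ⊆ openSquare)
    {s : ℝ} (hs1 : s ≤ 1) (hs : ∀ z, toPlane z ∈ U → Sep z s)
    (hfU : ∀ z, toPlane z ∈ U → f (B (toPlane z)) = σ z)
    {v : EuclideanSpace ℝ (Fin 2)} (hv : ∀ u ∈ U, dist u v < s) :
    ∃ w, IsInner w ∧ toPlane w = v ∧ f (B v) = σ w := by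
  obtain ⟨u₀, hu₀⟩ := hne
  obtain ⟨z₀, hz₀, rfl⟩ := mem_openSquare_iff.1 (hUo hu₀)
  obtain ⟨w, hw, hw', -⟩ := exists_inner_of_dist_lt hp hc hf h hs1 (hs z₀ hu₀) hz₀ (hfU z₀ hu₀)
    ((hB.dist_eq _ _).trans_lt (hv _ hu₀))
  refine ⟨w, hw, eq_of_equidistant hU ⟨_, hu₀⟩ fun u hu => ?_, hw'⟩
  obtain ⟨z, hz, rfl⟩ := mem_openSquare_iff.1 (hUo hu)
  rw [dist_eq_of_inner hp hc hf h hs1 (hs z hu) hz (hfU z hu)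
    ((hB.dist_eq _ _).trans_lt (hv _ hu)) hw', hB.dist_eq]

/-- If `f ∘ B` is the lifted square `σ` near one inner point, then on the whole closed square. -/
theorem chart_of_eventually (hp : IsCoveringMap p) [Nonempty E] (hc : ∀ a, ∃ e S, Γ.gen e S = a)
    (hf : ∀ x y, Γ.cellDist p (f x) (f y) = edist x y) {e : E}
    {σ : C(unitInterval × unitInterval, Y)} (h : Γ.IsLift p e σ)
    {B : EuclideanSpace ℝ (Fin 2) → EuclideanSpace ℝ (Fin 2)} (hB : Isometry B)
    {v₀ : EuclideanSpace ℝ (Fin 2)} (hv₀ : v₀ ∈ openSquare)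
    (hfB : ∀ᶠ v in 𝓝 v₀, f (B v) = σ (toSquare v)) (z : unitInterval × unitInterval) :
    f (B (toPlane z)) = σ z := by
  -- The set where the chart is valid locally is open; `extend_chart` shows that it is relatively
  -- closed in the connected open square.
  have hO : openSquare ⊆ openSquare ∩ {v | ∀ᶠ v' in 𝓝 v, f (B v') = σ (toSquare v')} := by
    refine isPreconnected_openSquare.subset_of_closure_inter_subset
      (isOpen_openSquare.inter isOpen_setOfPred_eventually_nhds) ⟨v₀, hv₀, hv₀, hfB⟩ ?_
    rintro v ⟨hv, hvO⟩
    refine ⟨hvO, ?_⟩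
    obtain ⟨z, hz, rfl⟩ := mem_openSquare_iff.1 hvO
    obtain ⟨r, hr, hr1, hs⟩ := exists_sep z
    obtain ⟨v', hv', hd⟩ := Metric.mem_closure_iff.1 hv (r / 4) (by linarith)
    -- Points of `U` keep separation at least `3r/4`, and they are within `r/2` of every point of
    -- the `r/4`-ball about `z`; this suits `extend_chart` with `s = r/2`.
    let U : Set (EuclideanSpace ℝ (Fin 2)) :=
      (Metric.ball (toPlane z) (r / 4) ∩ openSquare) ∩
        {v | ∀ᶠ v' in 𝓝 v, f (B v') = σ (toSquare v')}
    have hUo : IsOpen U :=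
      (Metric.isOpen_ball.inter isOpen_openSquare).inter isOpen_setOfPred_eventually_nhds
    have hne : U.Nonempty := ⟨v', ⟨Metric.mem_ball'.2 hd, hv'.1⟩, hv'.2⟩
    refine Filter.eventually_of_mem (Metric.ball_mem_nhds _ (show 0 < r / 4 by linarith)) ?_
    intro v'' hv''
    obtain ⟨w, -, rfl, hw⟩ := extend_chart hp hc hf h hB hUo hne (fun u hu => hu.1.2)
      (s := r / 2) (by linarith)
      (fun w hw => sep_of_le (hs.shift hz (Metric.mem_ball'.1 hw.1.1).le) (by linarith))
      (fun w hw => by simpa using hw.2.self_of_nhds) (v := v'')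
      (fun u hu => (dist_triangle_right _ _ (toPlane z)).trans_lt (by
        have := Metric.mem_ball.1 hu.1.1
        have := Metric.mem_ball.1 hv''
        linarith))
    simpa using hw
  -- Continuity of `f` for the topology of `Y` is not at hand, so the boundary is reached by short
  -- strings through nearby inner points.
  refine eq_of_short_strings hp hc fun ε hε => ?_
  obtain ⟨u, hu, hd⟩ :=
    Metric.mem_closure_iff.1 (toPlane_mem_closure_openSquare z) (ε / 2) (by linarith)
  obtain ⟨l, hl, hl'⟩ := exists_string hf (((hB.dist_eq (toPlane z) u)).trans_lt hd)
  obtain ⟨w, hw, rfl⟩ := mem_openSquare_iff.1 hu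
  have hw' : f (B (toPlane w)) = σ w := by simpa using (hO hu).2.self_of_nhds
  rw [hw'] at hl'
  refine ⟨_, ?_, IsString.square e σ h w z l hl'⟩
  rw [dist_comm] at hd
  push_cast
  linarith

/-- A lifted square of which an inner point lies on the plane is the image of a Euclidean unit
square. -/
theorem exists_chart (hp : IsCoveringMap p) [Nonempty E] (hc : ∀ a, ∃ e S, Γ.gen e S = a)
    (hf : ∀ x y, Γ.cellDist p (f x) (f y) = edist x y) {e : E}
    {σ : C(unitInterval × unitInterval, Y)} (h : Γ.IsLift p e σ)
    {z : unitInterval × unitInterval} (hz : IsInner z) {x : EuclideanSpace ℝ (Fin 2)}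
    (hx : f x = σ z) :
    ∃ L : EuclideanSpace ℝ (Fin 2) →ₗᵢ[ℝ] EuclideanSpace ℝ (Fin 2),
      ∀ w, f (x + L (toPlane w - toPlane z)) = σ w := by
  obtain ⟨r, hr, hr1, hs⟩ := exists_sep z
  -- The images of the points `x + ρ • ε i` have separation `r - ρ = 3ρ`, which exceeds their
  -- distance, at most `2ρ`, from the points `y` with `dist x y ≤ ρ`. So all sides of the triangle
  -- `x`, `x + ρ • ε i`, `y` are preserved, and hence its inner products.
  let ρ : ℝ := r / 4
  have hρ : 0 < ρ := by simp only [ρ]; linarith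
  let ε : OrthonormalBasis (Fin 2) ℝ (EuclideanSpace ℝ (Fin 2)) := EuclideanSpace.basisFun _ ℝ
  have hn : ∀ i, ‖ρ • ε i‖ = ρ := fun i => by
    rw [norm_smul, Real.norm_eq_abs, abs_of_pos hρ, ε.orthonormal.1 i, mul_one]
  have hd : ∀ i, dist x (x + ρ • ε i) = ρ := fun i => by rw [dist_self_add_right, hn]
  choose w hw hfw hzw using fun i => exists_inner_of_dist_lt hp hc hf h hr1 hs hz hx
    (y := x + ρ • ε i) (by rw [hd]; simp only [ρ]; linarith)
  have hsw : ∀ i, Sep (w i) (r - ρ) := fun i => hs.shift hz (by rw [hzw, hd])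
  let b : Fin 2 → EuclideanSpace ℝ (Fin 2) := fun i => ρ⁻¹ • (toPlane (w i) - toPlane z)
  have hbw : ∀ i, toPlane (w i) - toPlane z = ρ • b i := fun i => by
    simp [b, smul_smul, mul_inv_cancel₀ hρ.ne']
  clear_value b
  have inner_b : ∀ {y : EuclideanSpace ℝ (Fin 2)} {w' : unitInterval × unitInterval},
      dist x y ≤ ρ → f y = σ w' → dist (toPlane z) (toPlane w') = dist x y → ∀ i,
      inner ℝ (b i) (toPlane w' - toPlane z) = inner ℝ (ε i) (y - x) := by
    intro y w' hy hfy hd' i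
    have h1 : dist (x + ρ • ε i) y < r - ρ := by
      refine (dist_triangle_left _ _ x).trans_lt ?_
      rw [hd]
      have : 4 * ρ = r := by simp only [ρ]; ring
      linarith
    have h2 := dist_eq_of_inner hp hc hf h (by linarith) (hsw i) (hw i) (hfw i) h1 hfy
    have h3 : inner ℝ (ρ • b i) (toPlane w' - toPlane z) = inner ℝ (ρ • ε i) (y - x) := by
      refine inner_eq_inner_of_norm_eq ?_ ?_ ?_
      · rw [hn, ← hbw, ← dist_eq_norm, dist_comm, hzw, hd]
      · rw [← dist_eq_norm, ← dist_eq_norm, dist_comm, hd', dist_comm]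
      · rw [← hbw, sub_sub_sub_cancel_right, sub_sub_eq_add_sub, add_comm (ρ • ε i),
          ← dist_eq_norm, ← dist_eq_norm, h2]
    rw [real_inner_smul_left, real_inner_smul_left] at h3
    exact mul_left_cancel₀ hρ.ne' h3
  have hb : Orthonormal ℝ b := by
    rw [orthonormal_iff_ite]
    intro i j
    have h1 := inner_b (hd j).le (hfw j) (hzw j) i
    rw [hbw, real_inner_smul_right, add_sub_cancel_left, real_inner_smul_right] at h1
    rw [mul_left_cancel₀ hρ.ne' h1]
    exact orthonormal_iff_ite.1 ε.orthonormal i j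
  let β : OrthonormalBasis (Fin 2) ℝ (EuclideanSpace ℝ (Fin 2)) :=
    (basisOfOrthonormalOfCardEqFinrank hb (by simp)).toOrthonormalBasis (by simpa using hb)
  have hβ : ∀ i, β i = b i := fun i => by simp [β]
  -- Reading coordinates in the basis `b` carries `toPlane (w i) - toPlane z` to `ρ • ε i`, thus
  -- inverting the local behaviour of `f`.
  refine ⟨β.repr.toLinearIsometry, fun w' => ?_⟩
  refine chart_of_eventually hp hc hf h
    (B := fun v => x + β.repr.toLinearIsometry (v - toPlane z)) ?_
    (mem_openSquare_iff.2 ⟨z, hz, rfl⟩) ?_ w'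
  · refine Isometry.of_dist_eq fun u v => ?_
    rw [dist_add_left, LinearIsometry.dist_map, dist_sub_right]
  · refine Filter.eventually_of_mem (Metric.ball_mem_nhds _ hρ) fun v hv => ?_
    have hxv : dist x (x + β.repr.toLinearIsometry (v - toPlane z)) = dist (toPlane z) v := by
      rw [dist_self_add_right, LinearIsometry.norm_map, dist_comm, dist_eq_norm]
    have hv' := Metric.mem_ball'.1 hv
    obtain ⟨w', -, h1, h2⟩ := exists_inner_of_dist_lt hp hc hf h hr1 hs hz hx
      (y := x + β.repr.toLinearIsometry (v - toPlane z))
      (by rw [hxv]; refine hv'.trans ?_; simp only [ρ]; linarith)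
    have h3 := inner_b (hxv.trans_lt hv').le h1 h2
    have h4 : β.repr (toPlane w' - toPlane z) = β.repr (v - toPlane z) := by
      ext i
      rw [β.repr_apply_apply, hβ, h3 i, add_sub_cancel_left, ← ε.repr_apply_apply]
      rfl
    have h5 : toPlane w' = v := sub_left_injective (β.repr.injective h4)
    rw [h1, ← h5, toSquare_toPlane]

/-! ### Symmetries of the square and tiles of the plane. -/

/-- The symmetries `(d, i, j)` of the unit square: swap the coordinates if `d`, then reverse the
first one if `i` and the second one if `j`. The origin goes to the corner `(i, j)`. -/
def turn (k : Bool × Bool × Bool) (z : unitInterval × unitInterval) :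
    unitInterval × unitInterval :=
  (flip k.2.1 (cond k.1 z.swap z).1, flip k.2.2 (cond k.1 z.swap z).2)

@[simp] theorem flip_flip (b : Bool) (t : unitInterval) : flip b (flip b t) = t := by
  cases b <;> simp [flip]

theorem turn_surjective (k : Bool × Bool × Bool) : Function.Surjective (turn k) := by
  intro z
  obtain ⟨d, i, j⟩ := k
  cases d
  · exact ⟨(flip i z.1, flip j z.2), by simp [turn]⟩
  · exact ⟨(flip j z.2, flip i z.1), by simp [turn]⟩

theorem exists_turn_eq_sidePt (S : Bool × Bool) (b : Bool) :
    ∃ k, ∀ s, turn k (s, 0) = sidePt S (flip b s) := by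
  obtain ⟨d, i⟩ := S
  cases d
  · refine ⟨(false, b, i), fun s => ?_⟩
    cases i <;> simp [turn, sidePt, bit, flip]
  · refine ⟨(true, i, b), fun s => ?_⟩
    cases i <;> simp [turn, sidePt, bit, flip]

theorem turn_zero (d d' : Bool) (c : Bool × Bool) : turn (d, c) (0, 0) = turn (d', c) (0, 0) := by
  cases d <;> cases d' <;> simp [turn]

/-- The midpoint of the unit interval. -/
noncomputable def half : unitInterval := ⟨1 / 2, by norm_num, by norm_num⟩

theorem flip_half (b : Bool) : flip b half = half := by
  cases b
  · rfl
  · ext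
    simp [flip, half]
    norm_num

theorem turn_half (k : Bool × Bool × Bool) : turn k (half, half) = (half, half) := by
  obtain ⟨d, i, j⟩ := k
  cases d <;> simp [turn, flip_half]

theorem coe_flip (b : Bool) (t : unitInterval) :
    (flip b t : ℝ) = cond b 1 0 + cond b (-1) 1 * t := by
  cases b <;> simp [flip]
  ring

theorem toPlane_turn (k : Bool × Bool × Bool) (s t : unitInterval) :
    toPlane (turn k (s, t)) = toPlane (turn k (0, 0)) +
      (s : ℝ) • (toPlane (turn k (1, 0)) - toPlane (turn k (0, 0))) +
      (t : ℝ) • (toPlane (turn k (0, 1)) - toPlane (turn k (0, 0))) := by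
  obtain ⟨d, i, j⟩ := k
  ext l
  fin_cases l <;> cases d <;> simp [toPlane, turn, coe_flip] <;> ring

theorem norm_turn_fst (k : Bool × Bool × Bool) :
    ‖toPlane (turn k (1, 0)) - toPlane (turn k (0, 0))‖ = 1 := by
  obtain ⟨d, i, j⟩ := k
  cases d <;> cases i <;> cases j <;>
    simp [EuclideanSpace.norm_eq, toPlane, turn, coe_flip]

theorem norm_turn_snd (k : Bool × Bool × Bool) :
    ‖toPlane (turn k (0, 1)) - toPlane (turn k (0, 0))‖ = 1 := by
  obtain ⟨d, i, j⟩ := k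
  cases d <;> cases i <;> cases j <;>
    simp [EuclideanSpace.norm_eq, toPlane, turn, coe_flip]

theorem inner_turn (k : Bool × Bool × Bool) :
    inner ℝ (toPlane (turn k (1, 0)) - toPlane (turn k (0, 0)))
      (toPlane (turn k (0, 1)) - toPlane (turn k (0, 0))) = 0 := by
  obtain ⟨d, i, j⟩ := k
  cases d <;> simp [PiLp.inner_apply, toPlane, turn, coe_flip]

/-- In the plane the vectors orthogonal to `w` form a line; `k` and `k'` are the coordinates of `u`
and `w'` along the quarter turn of `w`, and both are `±1`. -/
theorem eq_or_eq_neg_of_orthogonal {u w w' : EuclideanSpace ℝ (Fin 2)} (hu : ‖u‖ = 1)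
    (hw : ‖w‖ = 1) (hw' : ‖w'‖ = 1) (h : inner ℝ u w = 0) (h' : inner ℝ w w' = 0) :
    w' = u ∨ w' = -u := by
  have e1 := (EuclideanSpace.norm_sq_eq u).symm
  have e2 := (EuclideanSpace.norm_sq_eq w).symm
  have e3 := (EuclideanSpace.norm_sq_eq w').symm
  rw [hu] at e1
  rw [hw] at e2
  rw [hw'] at e3
  simp only [PiLp.inner_apply, RCLike.inner_apply, Real.ringHom_apply,
    Fin.sum_univ_two, Real.norm_eq_abs, sq_abs] at h h' e1 e2 e3
  set k := w 0 * u 1 - w 1 * u 0 with hk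
  set k' := w 0 * w' 1 - w 1 * w' 0 with hk'
  have u0 : u 0 = -k * w 1 := by rw [hk]; linear_combination (-(u 0)) * e2 + w 0 * h
  have u1 : u 1 = k * w 0 := by rw [hk]; linear_combination (-(u 1)) * e2 + w 1 * h
  have v0 : w' 0 = -k' * w 1 := by rw [hk']; linear_combination (-(w' 0)) * e2 + w 0 * h'
  have v1 : w' 1 = k' * w 0 := by rw [hk']; linear_combination (-(w' 1)) * e2 + w 1 * h'
  have hkk : k ^ 2 = k' ^ 2 := by
    have a : k ^ 2 = 1 := by
      rw [u0, u1] at e1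
      linear_combination e1 - k ^ 2 * e2
    have b : k' ^ 2 = 1 := by
      rw [v0, v1] at e3
      linear_combination e3 - k' ^ 2 * e2
    rw [a, b]
  rcases sq_eq_sq_iff_eq_or_eq_neg.1 hkk with hk | hk
  · left
    ext i
    fin_cases i
    · simp only [Fin.zero_eta, v0, u0, hk]
    · simp only [Fin.mk_one, v1, u1, hk]
  · right
    ext i
    fin_cases i
    · simp only [Fin.zero_eta, PiLp.neg_apply, v0, u0, hk]; ring
    · simp only [Fin.mk_one, PiLp.neg_apply, v1, u1, hk]; ring

theorem not_isInner_sidePt (S : Bool × Bool) (t : unitInterval) : ¬ IsInner (sidePt S t) := by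
  obtain ⟨d, i⟩ := S
  cases d <;> cases i <;> simp [sidePt, bit, IsInner]

theorem not_isVertex_sidePt (S : Bool × Bool) {t : unitInterval} (h0 : t ≠ 0) (h1 : t ≠ 1) :
    ¬ IsVertex (sidePt S t) := by
  obtain ⟨d, i⟩ := S
  cases d <;> simp [sidePt, IsVertex, h0, h1]

/-- The unit square with corner `x` and sides `u` and `w` is mapped to the 2-cell `σ`, turned by
`k`. -/
def IsTile (f : EuclideanSpace ℝ (Fin 2) → Y) (x u w : EuclideanSpace ℝ (Fin 2))
    (k : Bool × Bool × Bool) (σ : C(unitInterval × unitInterval, Y)) : Prop :=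
  (‖u‖ = 1 ∧ ‖w‖ = 1 ∧ inner ℝ u w = 0) ∧
    ∀ s t : unitInterval, f (x + (s : ℝ) • u + (t : ℝ) • w) = σ (turn k (s, t))

theorem IsTile.fst {x u w : EuclideanSpace ℝ (Fin 2)} {k : Bool × Bool × Bool}
    {σ : C(unitInterval × unitInterval, Y)} (h : IsTile f x u w k σ) (s : unitInterval) :
    f (x + (s : ℝ) • u) = σ (turn k (s, 0)) := by
  simpa using h.2 s 0

theorem IsTile.snd {x u w : EuclideanSpace ℝ (Fin 2)} {k : Bool × Bool × Bool}
    {σ : C(unitInterval × unitInterval, Y)} (h : IsTile f x u w k σ) (t : unitInterval) :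
    f (x + (t : ℝ) • w) = σ (turn k (0, t)) := by
  simpa using h.2 0 t

theorem exists_isTile (hp : IsCoveringMap p) [Nonempty E] (hc : ∀ a, ∃ e S, Γ.gen e S = a)
    (hf : ∀ x y, Γ.cellDist p (f x) (f y) = edist x y) {e : E}
    {σ : C(unitInterval × unitInterval, Y)} (h : Γ.IsLift p e σ)
    {z : unitInterval × unitInterval} (hz : IsInner z) {y : EuclideanSpace ℝ (Fin 2)}
    (hy : f y = σ z) (k : Bool × Bool × Bool) : ∃ x u w, IsTile f x u w k σ := by
  obtain ⟨L, hL⟩ := exists_chart hp hc hf h hz hy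
  refine ⟨y + L (toPlane (turn k (0, 0)) - toPlane z),
    L (toPlane (turn k (1, 0)) - toPlane (turn k (0, 0))),
    L (toPlane (turn k (0, 1)) - toPlane (turn k (0, 0))), ⟨?_, ?_, ?_⟩, fun s t => ?_⟩
  · rw [L.norm_map, norm_turn_fst]
  · rw [L.norm_map, norm_turn_snd]
  · rw [L.inner_map_map, inner_turn]
  · rw [← hL, toPlane_turn k s t]
    simp only [map_add, map_sub, map_smul]
    congr 1
    abel

/-! ### The plane near 1-cells: existence of tiles and of their neighbours. -/

/-- Near a point mapped to an inner point of a 1-cell, every point is mapped to this 1-cell or to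
the interior of a 2-cell at this 1-cell. -/
theorem near_edge (hp : IsCoveringMap p) (hc : ∀ a, ∃ e S, Γ.gen e S = a)
    (hf : ∀ x y, Γ.cellDist p (f x) (f y) = edist x y) {e : E}
    {σ : C(unitInterval × unitInterval, Y)} (h : Γ.IsLift p e σ) {S : Bool × Bool}
    {t : unitInterval} (ht0 : t ≠ 0) (ht1 : t ≠ 1) {x y : EuclideanSpace ℝ (Fin 2)}
    (hx : f x = σ (sidePt S t)) {ε : ℝ} (h0 : ε ≤ t) (h1 : ε ≤ 1 - t) (hxy : dist x y < ε) :
    (∃ e' σ' S' w, Γ.IsLift p e' σ' ∧ (∀ s, σ' (sidePt S' s) = σ (sidePt S s)) ∧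
      IsInner w ∧ f y = σ' w) ∨ ∃ s : unitInterval, f y = σ (sidePt S s) ∧ |(t : ℝ) - s| < ε := by
  have hε : ε ≤ 1 := by linarith [t.2.1]
  obtain ⟨e', σ', z, w, h', hz, hw, hd⟩ := exists_square_of_dist_lt hp hc hf h hε
    (sep_sidePt h0 h1) hx le_rfl hxy
  have hs : Sep z ε := h.sep hp h' (hx.symm.trans hz.symm) hε (sep_sidePt h0 h1)
  rcases h.eq_cases hp h' (hx.symm.trans hz.symm) with hi | hv |
    ⟨S₁, S', t₁, -, -, h2, rfl, -, h3⟩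
  · exact absurd hi.1 (not_isInner_sidePt _ _)
  · exact absurd hv.1 (not_isVertex_sidePt _ ht0 ht1)
  obtain ⟨rfl, rfl⟩ := sidePt_eq ht0 ht1 h2
  rcases isInner_or_isVertex_or_sidePt w with hi | hv | ⟨S₂, s, -, -, rfl⟩
  · exact Or.inl ⟨e', σ', S', w, h', fun s => (h3 s).symm, hi, hw.symm⟩
  · rw [← hs.vertex hd hv] at hw
    exact absurd (hs.vertex hd hv ▸ hv) (not_isVertex_sidePt _ ht0 ht1)
  · obtain ⟨t₂, h4⟩ := hs.side hd
    obtain ⟨rfl, -⟩ := sidePt_eq ht0 ht1 h4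
    exact Or.inr ⟨s, by rw [← hw, h3], by rwa [dist_sidePt] at hd⟩

/-- Otherwise the plane lies in the 1-skeleton. A point close to `0` is then mapped to an inner
point of an edge, and a small circle about it would have to fit into that edge. -/
theorem exists_inner (hp : IsCoveringMap p) [Nonempty E] (hc : ∀ a, ∃ e S, Γ.gen e S = a)
    (hf : ∀ x y, Γ.cellDist p (f x) (f y) = edist x y) :
    ∃ x e σ z, Γ.IsLift p e σ ∧ IsInner z ∧ f x = σ z := by
  by_contra! hno
  let ε : OrthonormalBasis (Fin 2) ℝ (EuclideanSpace ℝ (Fin 2)) := EuclideanSpace.basisFun _ ℝ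
  have hn : ∀ i, ‖ε i‖ = 1 := ε.orthonormal.1
  have h01 : inner ℝ (ε 0) (ε 1) = 0 := ε.orthonormal.2 (by decide)
  clear_value ε
  obtain ⟨e₀, σ₀, z₀, h₀, hz₀⟩ := exists_isLift_mem hp hc (f 0)
  obtain ⟨r, hr, hr1, hs⟩ := exists_sep z₀
  have hdy : dist (0 : EuclideanSpace ℝ (Fin 2)) ((r / 2) • ε 0) < r := by
    rw [dist_zero_left, norm_smul, hn, Real.norm_eq_abs, abs_of_pos (by linarith)]
    linarith
  obtain ⟨e, σ, z, w, h, hz, hw, hd⟩ :=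
    exists_square_of_dist_lt hp hc hf h₀ hr1 hs hz₀.symm le_rfl hdy
  have hsz : Sep z r := h₀.sep hp h (hz₀.trans hz.symm) hr1 hs
  rcases isInner_or_isVertex_or_sidePt w with hi | hv | ⟨S, t, ht0, ht1, rfl⟩
  · exact hno _ e σ w h hi hw.symm
  · have h1 := flat_injective hf (hz.symm.trans ((congrArg σ (hsz.vertex hd hv)).trans hw))
    have h2 := congrArg norm h1
    rw [norm_zero, norm_smul, hn, Real.norm_eq_abs, abs_of_pos (by linarith)] at h2
    linarith
  -- Three points at distance `ρ` from the centre and at least `ρ` from each other land on the edge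
  -- at distances in `[ρ, 3ρ/2)` from `t`. Two of them are on the same side of `t`, hence less than
  -- `ρ` apart, which is impossible.
  obtain ⟨ρ, hρ, hρ0, hρ1⟩ : ∃ ρ : ℝ, 0 < ρ ∧ 3 / 2 * ρ ≤ t ∧ 3 / 2 * ρ ≤ 1 - t := by
    have h0 : 0 < (t : ℝ) := unitInterval.coe_pos.2 (unitInterval.pos_iff_ne_zero.2 ht0)
    have h1 : (t : ℝ) < 1 := unitInterval.coe_lt_one.2 (unitInterval.lt_one_iff_ne_one.2 ht1)
    refine ⟨min (t : ℝ) (1 - t) / 2, by have := lt_min h0 (sub_pos.2 h1); linarith, ?_, ?_⟩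
    · have := min_le_left (t : ℝ) (1 - t)
      linarith
    · have := min_le_right (t : ℝ) (1 - t)
      linarith
  have key : ∀ d : EuclideanSpace ℝ (Fin 2), ‖d‖ = 1 → ∃ s : unitInterval,
      f ((r / 2) • ε 0 + ρ • d) = σ (sidePt S s) ∧ |(t : ℝ) - s| < 3 / 2 * ρ ∧
        ρ ≤ |(t : ℝ) - s| := by
    intro d hd
    have hdd : dist ((r / 2) • ε 0) ((r / 2) • ε 0 + ρ • d) = ρ := by
      rw [dist_self_add_right, norm_smul, hd, Real.norm_eq_abs, abs_of_pos hρ, mul_one]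
    rcases near_edge hp hc hf h ht0 ht1 hw.symm hρ0 hρ1 (by rw [hdd]; linarith) with
      ⟨e', σ', S', w, h', -, hi, hw'⟩ | ⟨s, hs, hs'⟩
    · exact absurd hw' (hno _ e' σ' w h' hi)
    · refine ⟨s, hs, hs', ?_⟩
      have := dist_le_of_square hf h hw.symm hs
      rwa [hdd, dist_sidePt] at this
  have sep : ∀ {d d' : EuclideanSpace ℝ (Fin 2)} {s s' : unitInterval}, 1 ≤ dist d d' →
      f ((r / 2) • ε 0 + ρ • d) = σ (sidePt S s) → f ((r / 2) • ε 0 + ρ • d') = σ (sidePt S s') →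
      ρ ≤ |(s : ℝ) - s'| := by
    intro d d' s s' hdd hs hs'
    have := dist_le_of_square hf h hs hs'
    rw [dist_add_left, dist_smul₀, dist_sidePt, Real.norm_eq_abs, abs_of_pos hρ] at this
    nlinarith
  have hdist : ∀ {d d' : EuclideanSpace ℝ (Fin 2)}, ‖d‖ = 1 → ‖d'‖ = 1 → inner ℝ d d' ≤ 0 →
      1 ≤ dist d d' := by
    intro d d' hd hd' h
    rw [dist_eq_norm]
    have := norm_sub_sq_real d d'
    rw [hd, hd'] at this
    nlinarith [norm_nonneg (d - d')]
  obtain ⟨s₁, a₁, b₁, c₁⟩ := key (ε 0) (hn 0)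
  obtain ⟨s₂, a₂, b₂, c₂⟩ := key (ε 1) (hn 1)
  obtain ⟨s₃, a₃, b₃, c₃⟩ := key (-ε 0) (by rw [norm_neg, hn])
  have d₁ := sep (hdist (hn 0) (hn 1) h01.le) a₁ a₂
  have d₂ := sep (hdist (hn 0) (by rw [norm_neg, hn]) (by
    rw [inner_neg_right, real_inner_self_eq_norm_sq, hn]; norm_num)) a₁ a₃
  have d₃ := sep (hdist (hn 1) (by rw [norm_neg, hn]) (by
    rw [inner_neg_right, real_inner_comm, h01]; norm_num)) a₂ a₃
  rw [abs_lt] at b₁ b₂ b₃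
  rw [le_abs] at c₁ c₂ c₃ d₁ d₂ d₃
  rcases c₁ with c₁ | c₁ <;> rcases c₂ with c₂ | c₂ <;> rcases c₃ with c₃ | c₃ <;>
  first
  | (rcases d₁ with d₁ | d₁ <;> linarith)
  | (rcases d₂ with d₂ | d₂ <;> linarith)
  | (rcases d₃ with d₃ | d₃ <;> linarith)

theorem exists_turn_zero_left (k : Bool × Bool × Bool) :
    ∃ S b, ∀ t, turn k (0, t) = sidePt S (flip b t) := by
  obtain ⟨d, i, j⟩ := k
  cases d
  · exact ⟨(true, i), j, fun t => by cases i <;> simp [turn, sidePt, bit, flip]⟩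
  · exact ⟨(false, j), i, fun t => by cases j <;> simp [turn, sidePt, bit, flip]⟩

/-- Next to a tile at the corner `x` there is another one. -/
theorem IsTile.pivot (hp : IsCoveringMap p) [Nonempty E] (hc : ∀ a, ∃ e S, Γ.gen e S = a)
    (hf : ∀ x y, Γ.cellDist p (f x) (f y) = edist x y) {e : E}
    {σ : C(unitInterval × unitInterval, Y)} (h : Γ.IsLift p e σ)
    {x u w : EuclideanSpace ℝ (Fin 2)} {k : Bool × Bool × Bool} (ht : IsTile f x u w k σ) :
    ∃ e' σ' k', Γ.IsLift p e' σ' ∧ IsTile f x w (-u) k' σ' := by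
  obtain ⟨S, b, hS⟩ := exists_turn_zero_left k
  have hinj := flat_injective hf
  obtain ⟨hu, hw, huw⟩ := ht.1
  have huu : inner ℝ u u = 1 := by rw [real_inner_self_eq_norm_sq, hu, one_pow]
  have hh : (half : ℝ) = 1 / 2 := rfl
  have hh0 : half ≠ 0 := fun h => by
    have := congrArg Subtype.val h
    norm_num [half] at this
  have hh1 : half ≠ 1 := fun h => by
    have := congrArg Subtype.val h
    norm_num [half] at this
  have hm : f (x + (half : ℝ) • w) = σ (sidePt S half) := by
    rw [ht.snd, hS, flip_half]
  -- The test point lies just across the side `w`. If it is mapped to that side, injectivity fails.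
  -- Otherwise it is inner to a square at that side, whose tile extends along `u` or `-u`; the test
  -- point excludes `u`.
  have hd : dist (x + (half : ℝ) • w) (x + (half : ℝ) • w + (-1 / 4 : ℝ) • u) < 1 / 2 := by
    rw [dist_self_add_right, norm_smul, hu]
    norm_num
  rcases near_edge hp hc hf h hh0 hh1 hm (by rw [hh]) (by rw [hh]; norm_num) hd with
    ⟨e', σ', S', w₀, h', hS', hi, hy⟩ | ⟨s, hs, -⟩
  · obtain ⟨k', hk'⟩ := exists_turn_eq_sidePt S' b
    obtain ⟨x', u', w', ht'⟩ := exists_isTile hp hc hf h' hi hy k'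
    have hside : ∀ s : unitInterval, x' + (s : ℝ) • u' = x + (s : ℝ) • w := fun s =>
      hinj (by rw [ht'.fst, ht.snd, hk', hS, hS'])
    obtain rfl : x' = x := by simpa using hside 0
    obtain rfl : u' = w := by simpa using hside 1
    rcases eq_or_eq_neg_of_orthogonal hu hw ht'.1.2.1 huw ht'.1.2.2 with rfl | rfl
    · obtain ⟨⟨s, t⟩, hst⟩ := turn_surjective k' w₀
      have h1 := hinj ((ht'.2 s t).trans ((congrArg σ' hst).trans hy.symm))
      have h2 := congrArg (inner ℝ w') h1
      simp only [inner_add_right, real_inner_smul_right, huw, huu] at h2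
      linarith [t.2.1]
    · exact ⟨e', σ', k', h', ht'⟩
  · have h1 : f (x + (half : ℝ) • w + (-1 / 4 : ℝ) • u) = f (x + (flip b s : ℝ) • w) := by
      rw [hs, ht.snd, hS, flip_flip]
    have h2 := congrArg (inner ℝ u) (hinj h1)
    simp only [inner_add_right, real_inner_smul_right, huw, huu] at h2
    linarith

/-! ### From four tiles around a corner to a circuit in the link. -/

/-- The sides of a turned square at the corner where it starts, and the link vertices they define. -/
theorem exists_germs (Γ : LOG V E) (e : E) (k : Bool × Bool × Bool) :
    ∃ S b S' b', (∀ s, turn k (s, 0) = sidePt S (flip b s)) ∧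
      (∀ t, turn k (0, t) = sidePt S' (flip b' t)) ∧
      Γ.cornerEnds (e, k.2) = s((Γ.gen e S, b), (Γ.gen e S', b')) := by
  obtain ⟨d, i, j⟩ := k
  cases d
  · refine ⟨(false, j), i, (true, i), j, fun s => ?_, fun t => ?_, ?_⟩
    · cases j <;> simp [turn, sidePt, bit, flip]
    · cases i <;> simp [turn, sidePt, bit, flip]
    · cases i <;> simp [cornerEnds, gen]
  · refine ⟨(true, i), j, (false, j), i, fun s => ?_, fun t => ?_, ?_⟩
    · cases i <;> simp [turn, sidePt, bit, flip]
    · cases j <;> simp [turn, sidePt, bit, flip]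
    · rw [Sym2.eq_swap]
      cases i <;> simp [cornerEnds, gen]

/-- The parameter `1/3` is inner, so it identifies the generator, and reversal moves it, so it
identifies the end. -/
theorem edgeMap_flip_inj {a a' : V} {b b' : Bool}
    (h : ∀ s, Γ.edgeMap a (flip b s) = Γ.edgeMap a' (flip b' s)) : (a, b) = (a', b') := by
  let s : unitInterval := ⟨1 / 3, by norm_num, by norm_num⟩
  have hs : ∀ b, (flip b s : ℝ) ≠ 0 ∧ (flip b s : ℝ) ≠ 1 := by
    intro b
    cases b <;> norm_num [coe_flip, s]
  obtain ⟨rfl, h2⟩ := edgeMap_inj Γ (fun h => (hs b).1 (congrArg Subtype.val h))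
    (fun h => (hs b).2 (congrArg Subtype.val h)) (h s)
  have h3 := congrArg Subtype.val h2
  rw [coe_flip, coe_flip] at h3
  cases b <;> cases b' <;> first | rfl | (exfalso; norm_num [s] at h3)

/-- The abscissas of the four axis directions, in cyclic order. -/
def axisX : Fin 4 → ℤ := ![1, 0, -1, 0]

/-- The ordinates of the four axis directions, in cyclic order. -/
def axisY : Fin 4 → ℤ := ![0, 1, 0, -1]

/-- The corner of a tile is part of a circuit of length four. -/
theorem IsTile.exists_fourCircuit (hp : IsCoveringMap p) [Nonempty E]
    (hc : ∀ a, ∃ e S, Γ.gen e S = a) (hf : ∀ x y, Γ.cellDist p (f x) (f y) = edist x y) {e : E}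
    {σ : C(unitInterval × unitInterval, Y)} (h : Γ.IsLift p e σ)
    {x u w : EuclideanSpace ℝ (Fin 2)} {k : Bool × Bool × Bool} (ht : IsTile f x u w k σ) :
    ∃ v d, Γ.IsFourCircuit v d ∧ d 0 = (e, k.2) := by
  have hinj := flat_injective hf
  let D : Fin 4 → EuclideanSpace ℝ (Fin 2) := ![u, w, -u, -w]
  obtain ⟨hu, hw, huw⟩ := ht.1
  have hwu : inner ℝ w u = 0 := by rw [real_inner_comm, huw]
  have hDu : ∀ i, inner ℝ u (D i) = (axisX i : ℝ) := by
    intro i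
    fin_cases i <;> simp [D, axisX, huw, inner_neg_right, hu]
  have hDw : ∀ i, inner ℝ w (D i) = (axisY i : ℝ) := by
    intro i
    fin_cases i <;> simp [D, axisY, hwu, inner_neg_right, hw]
  have htiles : ∀ i, ∃ e' k' σ', (i = 0 → e' = e ∧ k' = k) ∧ Γ.IsLift p e' σ' ∧
      IsTile f x (D i) (D (i + 1)) k' σ' := by
    obtain ⟨e₁, σ₁, k₁, h₁, t₁⟩ := ht.pivot hp hc hf h
    obtain ⟨e₂, σ₂, k₂, h₂, t₂⟩ := t₁.pivot hp hc hf h₁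
    obtain ⟨e₃, σ₃, k₃, h₃, t₃⟩ := t₂.pivot hp hc hf h₂
    rw [neg_neg] at t₃
    intro i
    fin_cases i
    · exact ⟨e, k, σ, fun _ => ⟨rfl, rfl⟩, h, ht⟩
    · exact ⟨e₁, k₁, σ₁, fun h => absurd h (by decide), h₁, t₁⟩
    · exact ⟨e₂, k₂, σ₂, fun h => absurd h (by decide), h₂, t₂⟩
    · exact ⟨e₃, k₃, σ₃, fun h => absurd h (by decide), h₃, t₃⟩
  choose es ks σs h0 hl htile using htiles
  choose S b S' b' hS hS' hends using fun i => exists_germs Γ (es i) (ks i)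
  have hfst : ∀ i (s : unitInterval), f (x + (s : ℝ) • D i) = σs i (sidePt (S i) (flip (b i) s)) := fun i s => by
    rw [(htile i).fst, hS]
  have hsnd : ∀ i (s : unitInterval), f (x + (s : ℝ) • D (i + 1)) = σs i (sidePt (S' i) (flip (b' i) s)) :=
    fun i s => by rw [(htile i).snd, hS']
  have hD : Function.Injective D := by
    intro i j hij
    have e1 := (hDu i).symm.trans ((congrArg (inner ℝ u) hij).trans (hDu j))
    have e2 := (hDw i).symm.trans ((congrArg (inner ℝ w) hij).trans (hDw j))
    exact (by decide : ∀ i j, axisX i = axisX j → axisY i = axisY j → i = j) i j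
      (by exact_mod_cast e1) (by exact_mod_cast e2)
  -- The link vertices are the germs at `x` of the edges in the directions `D i`. Equal germs at the
  -- same point would have equal lifts, contradicting the injectivity of `f`.
  refine ⟨fun i => (Γ.gen (es i) (S i), b i), fun i => (es i, (ks i).2), ⟨?_, ?_, ?_⟩, ?_⟩
  · intro i j hij
    obtain ⟨hg, hb⟩ := Prod.mk.inj hij
    have h1 : σs i (sidePt (S i) (flip (b i) 0)) = σs j (sidePt (S j) (flip (b i) 0)) := by
      rw [← hfst i, hb, ← hfst j]
      simp
    have h2 := (hl i).side_eq hp (hl j) hg h1 (flip (b i) 1)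
    rw [← hfst i, hb, ← hfst j] at h2
    exact hD (by simpa using hinj h2)
  · intro i j hij
    obtain ⟨he, hk⟩ := Prod.mk.inj hij
    have hlj : Γ.IsLift p (es i) (σs j) := he ▸ hl j
    have h1 : σs i (turn (ks i) (0, 0)) = σs j (turn (ks i) (0, 0)) := by
      have : turn (ks i) (0, 0) = turn (ks j) (0, 0) :=
        (turn_zero (ks i).1 (ks j).1 (ks i).2).trans (by rw [hk])
      rw [← (htile i).2, this, ← (htile j).2]
      simp
    have h2 := (hl i).eq hp hlj h1
    -- Equal corners leave the swap `(ks i).1` undetermined. The centre of the square is fixed by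
    -- every symmetry, so the centres of the two tiles can be compared.
    have h3 : f (x + (half : ℝ) • D i + (half : ℝ) • D (i + 1)) =
        f (x + (half : ℝ) • D j + (half : ℝ) • D (j + 1)) := by
      rw [(htile i).2, (htile j).2, turn_half, turn_half, h2]
    have h4 := hinj h3
    have e1 := congrArg (inner ℝ u) h4
    have e2 := congrArg (inner ℝ w) h4
    simp only [inner_add_right, real_inner_smul_right, hDu, hDw, half] at e1 e2
    have f1 : (axisX i : ℝ) + axisX (i + 1) = axisX j + axisX (j + 1) := by linarith
    have f2 : (axisY i : ℝ) + axisY (i + 1) = axisY j + axisY (j + 1) := by linarith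
    exact (by decide : ∀ i j, axisX i + axisX (i + 1) = axisX j + axisX (j + 1) →
      axisY i + axisY (i + 1) = axisY j + axisY (j + 1) → i = j) i j
      (by exact_mod_cast f1) (by exact_mod_cast f2)
  · intro i
    have : (Γ.gen (es i) (S' i), b' i) = (Γ.gen (es (i + 1)) (S (i + 1)), b (i + 1)) := by
      refine edgeMap_flip_inj (Γ := Γ) fun s => ?_
      rw [← squareMap_sidePt, ← squareMap_sidePt, ← hl, ← hl, ← hsnd, ← hfst]
    rw [hends, this]
  · change (es 0, (ks 0).2) = _
    rw [(h0 0 rfl).1, (h0 0 rfl).2]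

/-- If a covering space of the complex contains an isometrically embedded plane, then there is a
2-cell all of whose corners are parts of circuits of length four. -/
theorem HasFlatPlane.exists_not_isPoisonCorner (hp : IsCoveringMap p) [Nonempty E]
    (hc : ∀ a, ∃ e S, Γ.gen e S = a) (h : Γ.HasFlatPlane p) :
    ∃ e, ∀ i j, ¬ Γ.IsPoisonCorner (e, i, j) := by
  obtain ⟨f, hf⟩ := h
  obtain ⟨y, e, σ, z, h, hz, hy⟩ := exists_inner hp hc hf
  refine ⟨e, fun i j hij => hij ?_⟩
  obtain ⟨x, u, w, ht⟩ := exists_isTile hp hc hf h hz hy (false, i, j)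
  obtain ⟨v, d, hvd, hd⟩ := ht.exists_fourCircuit hp hc hf h
  exact ⟨v, d, hvd, 0, hd⟩

/-! ### Poison corners of the star-shaped complexes. -/

/-- Two link vertices are joined by a corner. -/
def LinkAdj {V E : Type} (Γ : LOG V E) (x y : V × Bool) : Prop := ∃ c, Γ.cornerEnds c = s(x, y)

theorem isPoisonCorner_of_forall {V E : Type} (Γ : LOG V E) {c : Corner E} {x y : V × Bool}
    (hc : Γ.cornerEnds c = s(x, y))
    (h : ∀ x' y', Γ.LinkAdj y y' → Γ.LinkAdj y' x' → Γ.LinkAdj x' x → y' ≠ x → x' ≠ y → False) :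
    Γ.IsPoisonCorner c := by
  rintro ⟨v, d, ⟨hv, -, hd⟩, i, rfl⟩
  have e0 := hd i
  have e1 := hd (i + 1)
  have e2 := hd (i + 2)
  have e3 := hd (i + 3)
  have a1 : i + 1 + 1 = i + 2 := by rw [add_assoc]; rfl
  have a2 : i + 2 + 1 = i + 3 := by rw [add_assoc]; rfl
  have a3 : i + 3 + 1 = i := by rw [add_assoc]; exact add_zero i
  rw [a1] at e1
  rw [a2] at e2
  rw [a3] at e3
  have n1 : v (i + 2) ≠ v i := fun h => absurd (add_eq_left.1 (hv h)) (by decide)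
  have n2 : v (i + 3) ≠ v (i + 1) := fun h => absurd (add_left_cancel (hv h)) (by decide)
  -- The circuit may run through the corner in either direction; in the second case it is read
  -- backwards.
  rcases Sym2.eq_iff.1 (e0.symm.trans hc) with ⟨h1, h2⟩ | ⟨h1, h2⟩
  · rw [h1] at e3 n1
    rw [h2] at e1 n2
    exact h _ _ ⟨_, e1⟩ ⟨_, e2⟩ ⟨_, e3⟩ n1 n2
  · rw [h1] at e3 n1
    rw [h2] at e1 n2
    exact h _ _ ⟨_, e3.trans Sym2.eq_swap⟩ ⟨_, e2.trans Sym2.eq_swap⟩ ⟨_, e1.trans Sym2.eq_swap⟩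
      n2 n1

/-- The ends of the corners of the star-shaped complexes, in terms of indices and with `1` for the
finish and `0` for the start of a 1-cell. -/
def StarEdge (k a α b : ℕ) : Prop :=
  a < k ∧ ((α = 1 ∧ (a = 0 ∧ b = k ∨ b + 1 = a)) ∨ (α = 0 ∧ (a = 0 ∧ b + 1 = k ∨ 0 < a ∧ b = k)))

/-- A horizontal end is joined to both ends of the vertical side there, so `StarEdge` needs no
parameter for the end of the second generator. -/
theorem starEdge_of_linkAdj {k : ℕ} {x y : Fin (k + 1) × Bool} (h : (starLOT k).LinkAdj x y) :
    StarEdge k x.1 x.2.toNat y.1 ∨ StarEdge k y.1 y.2.toNat x.1 := by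
  obtain ⟨⟨e, i, j⟩, h⟩ := h
  have key : StarEdge k e i.toNat (if i then (starLOT k).tgt e else (starLOT k).src e : Fin (k + 1))
      := by
    have := e.2
    unfold StarEdge
    by_cases h0 : e.val = 0 <;> cases i <;>
      simp [starLOT, h0] <;> omega
  rcases Sym2.eq_iff.1 h with ⟨rfl, rfl⟩ | ⟨rfl, rfl⟩
  · exact Or.inl key
  · exact Or.inr key

theorem starLOT_cover {k : ℕ} (hk : 4 ≤ k) (a : Fin (k + 1)) :
    ∃ e S, (starLOT k).gen e S = a := by
  by_cases ha : a.val < k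
  · exact ⟨⟨a, ha⟩, (false, false), Fin.ext rfl⟩
  · refine ⟨⟨1, by omega⟩, (true, false), Fin.ext ?_⟩
    have := a.2
    simp [gen, starLOT]
    omega

theorem toNat_inj {a b : Bool} (h : a.toNat = b.toNat) : a = b := by
  cases a <;> cases b <;> simp_all

/-- Write `-` for starts and `+` for finishes. The neighbours of `aₖ±` are `a₀+` and `aᵢ-` for `1 ≤
i ≤ k - 1`. The chosen link edges are `a₀- aₖ₋₁-`, `a₁+ a₀+` and `aₑ+ aₑ₋₁-` for `e ≥ 2`. The second
end of each has only `aₖ±` as other neighbours, and no other neighbour of the first end is adjacent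
to these. Square `1` needs its own choice: `a₀-, a₁+, …, aₖ₋₁+` is a circuit of length `k`, so `a₁+
a₀-` is not poison when `k = 4`. -/
theorem starLOT_isPoisonCorner {k : ℕ} (hk : 4 ≤ k) (e : Fin k) :
    ∃ i j, (starLOT k).IsPoisonCorner (e, i, j) := by
  have he := e.2
  have ne : ∀ {x y : Fin (k + 1) × Bool}, x ≠ y → ¬ (x.1.val = y.1.val ∧ x.2.toNat = y.2.toNat) :=
    fun h h' => h (Prod.ext (Fin.ext h'.1) (toNat_inj h'.2))
  by_cases h0 : e.val = 0
  · refine ⟨false, false, isPoisonCorner_of_forall _ rfl fun x' y' h1 h2 h3 n1 n2 => ?_⟩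
    have h1 := starEdge_of_linkAdj h1
    have h2 := starEdge_of_linkAdj h2
    have h3 := starEdge_of_linkAdj h3
    have n1 := ne n1
    have n2 := ne n2
    simp only [starLOT, StarEdge, h0, if_true, Bool.false_eq_true, if_false, Bool.toNat_false,
      Fin.val_castSucc] at h1 h2 h3 n1 n2
    omega
  by_cases h0' : e.val = 1
  · refine ⟨true, true, isPoisonCorner_of_forall _ rfl fun x' y' h1 h2 h3 n1 n2 => ?_⟩
    have h1 := starEdge_of_linkAdj h1
    have h2 := starEdge_of_linkAdj h2
    have h3 := starEdge_of_linkAdj h3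
    have n1 := ne n1
    have n2 := ne n2
    simp only [starLOT, StarEdge, h0', if_true, one_ne_zero, if_false, Bool.toNat_true,
      Fin.val_castSucc, true_and, false_and, or_false, false_or, Nat.sub_self] at h1 h2 h3 n1 n2
    omega
  · refine ⟨true, false, isPoisonCorner_of_forall _ rfl fun x' y' h1 h2 h3 n1 n2 => ?_⟩
    have h1 := starEdge_of_linkAdj h1
    have h2 := starEdge_of_linkAdj h2
    have h3 := starEdge_of_linkAdj h3
    have n1 := ne n1
    have n2 := ne n2
    simp only [starLOT, StarEdge, h0, if_true, if_false, Bool.toNat_true, Bool.toNat_false,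
      Fin.val_castSucc] at h1 h2 h3 n1 n2
    omega

theorem starLOT_not_hasFlatPlane {k : ℕ} (hk : 4 ≤ k) {Y : Type*} [TopologicalSpace Y]
    {p : Y → (starLOT k).Complex} (hp : (starLOT k).IsUniversalCover p) :
    ¬ (starLOT k).HasFlatPlane p := by
  intro h
  have : Nonempty (Fin k) := ⟨⟨0, by omega⟩⟩
  obtain ⟨e, he⟩ := h.exists_not_isPoisonCorner hp.1 (starLOT_cover hk)
  obtain ⟨i, j, hij⟩ := starLOT_isPoisonCorner hk e
  exact he i j hij

end LOG

/-- The universal cover of the presentation complex of the five-generator LOT group contains no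
isometrically embedded flat plane, and every square of the complex has a poison corner; the same
holds for the analogous LOT complexes with `k + 1` generators, `k ≥ 4`. -/
theorem mainTheorem3 :
    ((∀ (Y : Type*) [TopologicalSpace Y] (p : Y → LOG.fiveLOT.Complex),
        LOG.fiveLOT.IsUniversalCover p → ¬ LOG.fiveLOT.HasFlatPlane p) ∧
      ∀ e : Fin 4, ∃ i j : Bool, LOG.fiveLOT.IsPoisonCorner (e, i, j)) ∧
    ∀ k : ℕ, 4 ≤ k →
      (∀ (Y : Type*) [TopologicalSpace Y] (p : Y → (LOG.starLOT k).Complex),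
        (LOG.starLOT k).IsUniversalCover p → ¬ (LOG.starLOT k).HasFlatPlane p) ∧
      ∀ e : Fin k, ∃ i j : Bool, (LOG.starLOT k).IsPoisonCorner (e, i, j) := by
  refine ⟨?_, fun k hk =>
    ⟨fun Y _ p hp => LOG.starLOT_not_hasFlatPlane hk hp, LOG.starLOT_isPoisonCorner hk⟩⟩
  rw [← LOG.starLOT_four]
  exact ⟨fun Y _ p hp => LOG.starLOT_not_hasFlatPlane le_rfl hp,
    LOG.starLOT_isPoisonCorner le_rfl⟩
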